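/- Let $N\ge 3$, $0<d_{\min}<d_{\max}$ and $T_{\rm s}>0$. Let $N$ anchors be placed independently and uniformly at random in the annulus $\{z\in\mathbb{R}^2: d_{\min}\le |z|\le d_{\max}\}$, with polar coordinates $(R_k,\Theta_k)$, $\Theta_k\in[0,2\pi)$, $k=1,\dots,N$. The squared position error bound (SPEB) of a target at the origin is $$S=\operatorname{tr}\Big(\Big(\sum_{k=1}^N \frac{T_{\rm s}}{R_k^{2}}\,u(\Theta_k)u(\Theta_k)^T\Big)^{-1}\Big),\qquad u(\theta)=(\cos\theta,\sin\theta)^T .$$ Put $A_k=R_k^{-2}$, $X_N=\sum_k A_k$, $B_{k,N}=A_k/X_N$, $$Y_N=1-\Big(\sum_k B_{k,N}\cos 2\Theta_k\Big)^2-\Big(\sum_k B_{k,N}\sin 2\Theta_k\Big)^2,\qquad W_N=1-\frac1{N^2}\Big[\Big(\sum_k \cos 2\Theta_k\Big)^2+\Big(\sum_k \sin 2\Theta_k\Big)^2\Big],$$ $v_{\rm opt}=\mathbb{E}[Y_N]/(1-1/N)$ and $V_N=v_{\rm opt}W_N$. Almost surely the matrix in the definition of $S$ is invertible, $X_NY_N>0$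 and $S=4/(T_{\rm s}X_NY_N)$. The SPEB is approximated by $S_{\rm app}=4/(T_{\rm s}X_NV_N)$, that is, $Y_N$ is replaced by $V_N$; almost surely $X_NV_N>0$. Then $X_N$ and $W_N$ are independent, and for every $u>0$ the ccdf of the approximation is $$\mathbb{P}(S_{\rm app}>u)=1-\mathbb{E}_{X_N}\Big[\overline F_{W_N}\Big(\frac{4}{T_{\rm s}\,u\,X_N\,v_{\rm opt}}\Big)\Big].$$ Here: (a) $\overline F_{W_N}(w)=\mathbb{P}(W_N>w)$ equals $1$ for $w<0$, $0$ for $w>1$, and $N\sqrt{1-w}\int_0^\infty J_1(N\sqrt{1-w}\,y)\,J_0(y)^N\,dy$ for $w\in[0,1]$, where $J_0,J_1$ are Bessel functions of the first kind; (b) for all real $x$, $\mathbb{P}(X_N>x)=\frac12+\frac1\pi\int_0^\infty \operatorname{Im}\{e^{-itx}\varphi_{X_N}(t)\}\,\frac{dt}{t}$, where the characteristic function of $X_N$ is $\varphi_{X_N}(t)=\varphi_{A_1}(t)^N$ with $$\varphi_{A_1}(t)=\frac{1}{d_{\max}^2-d_{\min}^2}\Big[d_{\max}^2e^{it/d_{\max}^2}-d_{\min}^2e^{it/d_{\min}^2}+t\,{\rm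 H}\Big(\frac{t}{d_{\max}^2}\Big)-t\,{\rm H}\Big(\frac{t}{d_{\min}^2}\Big)\Big],$$ ${\rm H}={\rm Si}-i\,{\rm Ci}$, ${\rm Si}(x)=\int_0^x\frac{\sin t}{t}dt$, ${\rm Ci}(x)=-\int_x^\infty\frac{\cos t}{t}dt$ (a principal value at $0$ if $x<0$), and $t\,{\rm H}(\cdot)$ is read as $0$ at $t=0$; (c) $$\mathbb{E}[Y_N]=1-N\Big(\frac{\rho_{\max}^2+\rho_{\min}^2}{2}+\frac2\pi\int_{\rho_{\min}}^{\rho_{\max}}\int_0^\infty u\,\frac{\operatorname{Im}\{\varphi_{A_1}((1-u)t)\,\varphi_{A_1}(-ut)^{N-1}\}}{t}\,dt\,du\Big),$$ with $\rho_{\min}=\frac{d_{\max}^{-2}}{d_{\max}^{-2}+(N-1)d_{\min}^{-2}}$ and $\rho_{\max}=\frac{d_{\min}^{-2}}{d_{\min}^{-2}+(N-1)d_{\max}^{-2}}$. The integrals over $(0,\infty)$ in (a), (b) and (c) converge absolutely, as does the outer integral in (c); the expectations exist. -/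

import Mathlib

open MeasureTheory ProbabilityTheory Set Filter Topology

noncomputable section

namespace SPEB

/-! ### Anchors: a binomial point process on an annulus around the target at the origin

The plane is identified with `ℂ` (with its Lebesgue measure). -/

/-- The closed annulus with inner radius `dmin` and outer radius `dmax`, centred at the origin. -/
def annulus (dmin dmax : ℝ) : Set ℂ := {z | dmin ≤ ‖z‖ ∧ ‖z‖ ≤ dmax}

/-- `P 0, …, P (N-1)` is a binomial point process on `s`: the points are independent, and each of
them is uniformly distributed on `s`. -/
structure IsBPP {Ω : Type*} [MeasurableSpace Ω] {N : ℕ} (μ : Measure Ω) (P : Fin N → Ω → ℂ)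
    (s : Set ℂ) : Prop where
  measurable : ∀ k, Measurable (P k)
  indep : iIndepFun P μ
  uniform : ∀ k, pdf.IsUniform (P k) s μ volume

/-- The polar angle of a point of the plane, in `[0, 2π)`. The polar radius is `‖z‖`. -/
def angle (z : ℂ) : ℝ := if z.arg < 0 then z.arg + 2 * Real.pi else z.arg

/-- The unit vector in direction `θ`. -/
def unitVec (θ : ℝ) : Fin 2 → ℝ := ![Real.cos θ, Real.sin θ]

variable {N : ℕ}

/-- The `2 × 2` information matrix `∑ₖ λₖ u(Θₖ) u(Θₖ)ᵀ` of an anchor configuration `p`, where the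
ranging information intensity follows the inverse-square law `λₖ = Ts / Rₖ²`. -/
def infoMatrix (Ts : ℝ) (p : Fin N → ℂ) : Matrix (Fin 2) (Fin 2) ℝ :=
  ∑ k, (Ts / ‖p k‖ ^ 2) • Matrix.vecMulVec (unitVec (angle (p k))) (unitVec (angle (p k)))

/-- The squared position error bound, the trace of the inverse information matrix. -/
def speb (Ts : ℝ) (p : Fin N → ℂ) : ℝ := ((infoMatrix Ts p)⁻¹).trace

/-! ### The random variables, as functions of the anchor configuration -/

/-- `Aₖ = Rₖ⁻²`. -/
def A (p : Fin N → ℂ) (k : Fin N) : ℝ := (‖p k‖ ^ 2)⁻¹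

/-- `X_N = ∑ₖ Aₖ`. -/
def X (p : Fin N → ℂ) : ℝ := ∑ k, A p k

/-- `B_{k,N} = Aₖ / X_N`. -/
def B (p : Fin N → ℂ) (k : Fin N) : ℝ := A p k / X p

/-- `Y_N = 1 - (∑ₖ B_{k,N} cos 2Θₖ)² - (∑ₖ B_{k,N} sin 2Θₖ)²`. -/
def Y (p : Fin N → ℂ) : ℝ :=
  1 - (∑ k, B p k * Real.cos (2 * angle (p k))) ^ 2
    - (∑ k, B p k * Real.sin (2 * angle (p k))) ^ 2

/-- `W_N = 1 - N⁻² [(∑ₖ cos 2Θₖ)² + (∑ₖ sin 2Θₖ)²]`. -/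
def W (p : Fin N → ℂ) : ℝ :=
  1 - 1 / (N : ℝ) ^ 2 *
    ((∑ k, Real.cos (2 * angle (p k))) ^ 2 + (∑ k, Real.sin (2 * angle (p k))) ^ 2)

/-- The value of the random configuration at `ω`. -/
def config {Ω : Type*} (P : Fin N → Ω → ℂ) (ω : Ω) : Fin N → ℂ := fun k => P k ω

/-- `v_opt = E[Y_N] / (1 - 1/N)`. -/
def vOpt {Ω : Type*} [MeasurableSpace Ω] (μ : Measure Ω) (P : Fin N → Ω → ℂ) : ℝ :=
  (∫ ω, Y (config P ω) ∂μ) / (1 - 1 / (N : ℝ))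

/-- `V_N = v_opt W_N`. -/
def V {Ω : Type*} [MeasurableSpace Ω] (μ : Measure Ω) (P : Fin N → Ω → ℂ) (ω : Ω) : ℝ :=
  vOpt μ P * W (config P ω)

/-- The approximation `4 / (Ts X_N V_N)` of the squared position error bound. -/
def spebApprox {Ω : Type*} [MeasurableSpace Ω] (μ : Measure Ω) (P : Fin N → Ω → ℂ) (Ts : ℝ)
    (ω : Ω) : ℝ :=
  4 / (Ts * X (config P ω) * V μ P ω)

/-! ### Special functions and closed forms -/

/-- The Bessel function `J_n` of the first kind and integer order, by Bessel's integral. -/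
def besselJ (n : ℕ) (x : ℝ) : ℝ :=
  1 / Real.pi * ∫ τ in (0 : ℝ)..Real.pi, Real.cos (n * τ - x * Real.sin τ)

/-- The integrand of the random-walk formula. -/
def besselIntegrand (N : ℕ) (w y : ℝ) : ℝ :=
  besselJ 1 (N * Real.sqrt (1 - w) * y) * besselJ 0 y ^ N

/-- The random-walk (Bessel integral) formula for the ccdf of `W_N`. -/
def besselCcdf (N : ℕ) (w : ℝ) : ℝ :=
  if w < 0 then 1
  else if w ≤ 1 then N * Real.sqrt (1 - w) * ∫ y in Ioi (0 : ℝ), besselIntegrand N w y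
  else 0

/-- The sine integral. -/
def Si (x : ℝ) : ℝ := ∫ t in (0 : ℝ)..x, Real.sin t / t

/-- The cosine integral `Ci x = -∫ₓ^∞ cos t / t dt`, an improper (conditionally convergent)
integral. For `x < 0` it is a Cauchy principal value at `0`; as `cos t / t` is odd, the part over
`[x, -x]` cancels, which leaves the integral from `|x|`. -/
def Ci (x : ℝ) : ℝ := -limUnder atTop (fun b : ℝ => ∫ t in |x|..b, Real.cos t / t)

/-- `H = Si - i Ci`. -/
def H (x : ℝ) : ℂ := (Si x : ℂ) - Complex.I * (Ci x : ℂ)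

/-- The closed form of the characteristic function of `A₁ = R₁⁻²`. -/
def phiA (dmin dmax t : ℝ) : ℂ :=
  1 / ((dmax : ℂ) ^ 2 - (dmin : ℂ) ^ 2) *
    ((dmax : ℂ) ^ 2 * Complex.exp (Complex.I * ((t / dmax ^ 2 : ℝ) : ℂ))
      - (dmin : ℂ) ^ 2 * Complex.exp (Complex.I * ((t / dmin ^ 2 : ℝ) : ℂ))
      + (t : ℂ) * H (t / dmax ^ 2) - (t : ℂ) * H (t / dmin ^ 2))

/-- The closed form of the characteristic function of `X_N`. -/
def phiX (N : ℕ) (dmin dmax t : ℝ) : ℂ := phiA dmin dmax t ^ N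

/-- The Gil-Pelaez integrand at `x`, for the characteristic function `φ`. -/
def gilPelaezIntegrand (φ : ℝ → ℂ) (x t : ℝ) : ℝ :=
  (Complex.exp (-(Complex.I * (t : ℂ) * (x : ℂ))) * φ t).im / t

/-- The Gil-Pelaez inversion formula for the ccdf with characteristic function `φ`. -/
def gilPelaezCcdf (φ : ℝ → ℂ) (x : ℝ) : ℝ :=
  1 / 2 + 1 / Real.pi * ∫ t in Ioi (0 : ℝ), gilPelaezIntegrand φ x t

/-- The smallest value of `B_{1,N}`. -/
def rhoMin (N : ℕ) (dmin dmax : ℝ) : ℝ :=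
  (dmax ^ 2)⁻¹ / ((dmax ^ 2)⁻¹ + ((N : ℝ) - 1) * (dmin ^ 2)⁻¹)

/-- The largest value of `B_{1,N}`. -/
def rhoMax (N : ℕ) (dmin dmax : ℝ) : ℝ :=
  (dmin ^ 2)⁻¹ / ((dmin ^ 2)⁻¹ + ((N : ℝ) - 1) * (dmax ^ 2)⁻¹)

/-- The closed form of the characteristic function of `(1 - u) A₁ - u ∑_{j ≥ 2} Aⱼ`. -/
def phiT (N : ℕ) (dmin dmax u t : ℝ) : ℂ :=
  phiA dmin dmax ((1 - u) * t) * phiA dmin dmax (-(u * t)) ^ (N - 1)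

/-- The integrand `u Im φ_T(t) / t` of the formula for `E[Y_N]`. -/
def meanIntegrand (N : ℕ) (dmin dmax u t : ℝ) : ℝ := u * ((phiT N dmin dmax u t).im / t)

/-- The closed form of `E[Y_N]`. -/
def meanY (N : ℕ) (dmin dmax : ℝ) : ℝ :=
  1 - N * ((rhoMax N dmin dmax ^ 2 + rhoMin N dmin dmax ^ 2) / 2
    + 2 / Real.pi * ∫ u in rhoMin N dmin dmax..rhoMax N dmin dmax,
        ∫ t in Ioi (0 : ℝ), meanIntegrand N dmin dmax u t)

end SPEB

end

/-! Doubling the angles turns the information matrix into one with trace `Ts X` and determinant `Ts²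
X² Y / 4`, so the SPEB is `4 / (Ts X Y)`. Since the weights `B` sum to 1, `Y = ∑ⱼₖ Bⱼ Bₖ (1 - cos
(2Θⱼ - 2Θₖ))`, which is positive as soon as two angles differ modulo π.

In polar coordinates the uniform law on the annulus is a product, so all radii are jointly
independent of all angles (`IsBPP.indepFun_norm_arg`). Hence `X`, a function of the radii, is
independent of `W`, a function of the angles.

Law of `W`: `N² (1 - W)` is the squared length of a planar random walk with unit steps, whose
characteristic function is `J₀(|ξ|)^N`. Integrating against the Fourier transform of a disc gives
Kluyver's formula (`measureReal_norm_lt`). The disc is smoothed by a heat kernel to justify Fubini,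
and `J₀ = O(y^(-1/2))` with `N ≥ 3` gives absolute convergence.

Law of `X`: `R²` is uniform on `[dmin², dmax²]`, so the characteristic function of `R⁻²` is the mean
of `exp (it/s)`, which has an antiderivative in terms of `H`. It is `O(1/t)`, so Gil-Pelaez
inversion converges absolutely for every nonzero linear combination of the `Aₖ`
(`IsBPP.gilPelaez_sum_A`).

Mean of `Y`: averaging over the angles kills the cross terms and leaves `1 - N E[B₁²]`. A layer-cake
formula reduces the second moment to `P(B₁ > u)`, and `B₁ > u` is the sign condition `(1 - u) A₁ - u
∑_{j ≥ 2} Aⱼ > 0`, again a case of Gil-Pelaez.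

Finally, `S_app > u` means `W < 4 / (Ts u X v_opt)`; ties are null because `X` has no atoms, and
Fubini gives the expectation over `X`. -/

namespace SPEB

set_option linter.unusedSectionVars false

/-! ### Bessel functions of order zero and one -/

lemma integral_cos_mul_comp_sin {g : ℝ → ℝ} (hg : Continuous g) :
    ∫ τ in (0 : ℝ)..Real.pi, Real.cos τ * g (Real.sin τ) = 0 := by
  have h := intervalIntegral.integral_comp_mul_deriv (a := 0) (b := Real.pi) (f := Real.sin)
    (f' := Real.cos) (g := g) (fun x _ => Real.hasDerivAt_sin x) Real.continuous_cos.continuousOn hg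
  simp only [Function.comp_apply, Real.sin_zero, Real.sin_pi, intervalIntegral.integral_same] at h
  simpa [mul_comm] using h

lemma besselJ_zero_eq (x : ℝ) :
    besselJ 0 x = 1 / Real.pi * ∫ τ in (0 : ℝ)..Real.pi, Real.cos (x * Real.sin τ) := by
  simp [besselJ]

lemma besselJ_one_eq (x : ℝ) : besselJ 1 x =
    1 / Real.pi * ∫ τ in (0 : ℝ)..Real.pi, Real.sin τ * Real.sin (x * Real.sin τ) := by
  -- The `cos τ cos (x sin τ)` half of the integrand integrates to 0: the substitution `s = sin τ`
  -- runs from 0 back to 0.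
  have h := integral_cos_mul_comp_sin (g := fun s => Real.cos (x * s)) (by fun_prop)
  have : ∀ τ : ℝ, Real.cos ((1 : ℕ) * τ - x * Real.sin τ)
      = Real.cos τ * Real.cos (x * Real.sin τ) + Real.sin τ * Real.sin (x * Real.sin τ) := by
    intro τ
    rw [Nat.cast_one, one_mul, Real.cos_sub]
  simp only [besselJ, this]
  rw [intervalIntegral.integral_add (Continuous.intervalIntegrable (by fun_prop) _ _)
    (Continuous.intervalIntegrable (by fun_prop) _ _), h, zero_add]

lemma hasDerivAt_besselJ_zero (x : ℝ) : HasDerivAt (besselJ 0) (-besselJ 1 x) x := by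
  have h := (intervalIntegral.hasDerivAt_integral_of_dominated_loc_of_deriv_le (μ := volume)
    (a := 0) (b := Real.pi) (F := fun x τ => Real.cos (x * Real.sin τ))
    (F' := fun x τ => -(Real.sin τ * Real.sin (x * Real.sin τ))) (x₀ := x) (bound := fun _ => 1)
    (s := univ) univ_mem (.of_forall fun y => Continuous.aestronglyMeasurable (by fun_prop))
    (Continuous.intervalIntegrable (by fun_prop) _ _)
    (Continuous.aestronglyMeasurable (by fun_prop))
    (.of_forall fun t _ y _ => by
      rw [norm_neg, norm_mul]
      exact mul_le_one₀ (Real.abs_sin_le_one _) (norm_nonneg _) (Real.abs_sin_le_one _))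
    (by simp)
    (.of_forall fun t _ y _ => by
      have := ((hasDerivAt_id y).mul_const (Real.sin t)).cos
      refine this.congr_deriv ?_
      simp only [id]; ring)).2
  have h2 := h.const_mul (1 / Real.pi)
  rw [intervalIntegral.integral_neg] at h2
  have e : besselJ 0 = fun x => 1 / Real.pi * ∫ τ in (0 : ℝ)..Real.pi, Real.cos (x * Real.sin τ) :=
    funext besselJ_zero_eq
  rw [e, besselJ_one_eq]
  exact h2.congr_deriv (by ring)

/-- The relation `J₁' = J₀ - J₁ / x`, cleared of its denominator so that it includes `x = 0`. It
comes from integrating `sin (x sin τ) sin τ` by parts and using `sin² + cos² = 1`. -/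
lemma exists_hasDerivAt_besselJ_one (x : ℝ) :
    ∃ D, HasDerivAt (besselJ 1) D x ∧ besselJ 1 x = x * (besselJ 0 x - D) := by
  have h := (intervalIntegral.hasDerivAt_integral_of_dominated_loc_of_deriv_le (μ := volume)
    (a := 0) (b := Real.pi) (F := fun x τ => Real.sin τ * Real.sin (x * Real.sin τ))
    (F' := fun x τ => Real.sin τ ^ 2 * Real.cos (x * Real.sin τ)) (x₀ := x) (bound := fun _ => 1)
    (s := univ) univ_mem (.of_forall fun y => Continuous.aestronglyMeasurable (by fun_prop))
    (Continuous.intervalIntegrable (by fun_prop) _ _)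
    (Continuous.aestronglyMeasurable (by fun_prop))
    (.of_forall fun t _ y _ => by
      rw [norm_mul, norm_pow]
      exact mul_le_one₀ (pow_le_one₀ (norm_nonneg _) (Real.abs_sin_le_one _)) (norm_nonneg _)
        (Real.abs_cos_le_one _))
    (by simp)
    (.of_forall fun t _ y _ => by
      have := ((hasDerivAt_id y).mul_const (Real.sin t)).sin.const_mul (Real.sin t)
      refine this.congr_deriv ?_
      simp only [id]; ring)).2
  have h2 := h.const_mul (1 / Real.pi)
  have e : besselJ 1 = fun x => 1 / Real.pi * ∫ τ in (0 : ℝ)..Real.pi,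
      Real.sin τ * Real.sin (x * Real.sin τ) := funext besselJ_one_eq
  refine ⟨_, by rw [e]; exact h2, ?_⟩
  rw [besselJ_zero_eq, besselJ_one_eq, ← mul_sub, ← intervalIntegral.integral_sub
    (Continuous.intervalIntegrable (by fun_prop) _ _)
    (Continuous.intervalIntegrable (by fun_prop) _ _), mul_left_comm,
    ← intervalIntegral.integral_const_mul x]
  congr 1
  have hp := intervalIntegral.integral_mul_deriv_eq_deriv_mul (a := 0) (b := Real.pi)
    (u := fun τ => Real.sin (x * Real.sin τ)) (v := fun τ => -Real.cos τ)
    (u' := fun τ => Real.cos (x * Real.sin τ) * (x * Real.cos τ)) (v' := Real.sin)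
    (fun t _ => ((Real.hasDerivAt_sin t).const_mul x).sin)
    (fun t _ => (Real.hasDerivAt_cos t).neg.congr_deriv (neg_neg _))
    (Continuous.intervalIntegrable (by fun_prop) _ _)
    (Continuous.intervalIntegrable (by fun_prop) _ _)
  simp only [Real.sin_pi, Real.sin_zero, mul_zero, zero_mul, sub_zero, zero_sub] at hp
  calc _ = ∫ t in (0 : ℝ)..Real.pi, Real.sin (x * Real.sin t) * Real.sin t := by
        simp only [mul_comm]
    _ = _ := by
        rw [hp, ← intervalIntegral.integral_neg]
        refine intervalIntegral.integral_congr fun t _ => ?_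
        linear_combination (x * Real.cos (x * Real.sin t)) * (Real.sin_sq_add_cos_sq t)

lemma continuous_besselJ_zero : Continuous (besselJ 0) :=
  continuous_iff_continuousAt.2 fun x => (hasDerivAt_besselJ_zero x).continuousAt

lemma continuous_besselJ_one : Continuous (besselJ 1) :=
  continuous_iff_continuousAt.2 fun x =>
    let ⟨_, h, _⟩ := exists_hasDerivAt_besselJ_one x; h.continuousAt

lemma hasDerivAt_mul_besselJ_one (x : ℝ) :
    HasDerivAt (fun x => x * besselJ 1 x) (x * besselJ 0 x) x := by
  obtain ⟨D, h, h'⟩ := exists_hasDerivAt_besselJ_one x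
  refine ((hasDerivAt_id x).mul h).congr_deriv ?_
  simp only [id, h']; ring

lemma hasDerivAt_besselJ_one {x : ℝ} (hx : x ≠ 0) :
    HasDerivAt (besselJ 1) (besselJ 0 x - besselJ 1 x / x) x := by
  obtain ⟨D, h, h'⟩ := exists_hasDerivAt_besselJ_one x
  refine h.congr_deriv ?_
  rw [h']; field_simp; ring

lemma abs_besselJ_le_one (n : ℕ) (x : ℝ) : |besselJ n x| ≤ 1 := by
  have h := intervalIntegral.norm_integral_le_of_norm_le_const (a := 0) (b := Real.pi) (C := 1)
    (f := fun τ => Real.cos (n * τ - x * Real.sin τ)) (fun t _ => Real.abs_cos_le_one _)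
  rw [besselJ, abs_mul, abs_of_pos (by positivity)]
  simp only [Real.norm_eq_abs, one_mul, sub_zero, abs_of_pos Real.pi_pos] at h
  rw [one_div, inv_mul_le_iff₀ Real.pi_pos, mul_one]
  exact h

/-- The energy of `√x J₀` as a solution of the normalized Bessel equation decreases,
which bounds `√x J₀`. -/
lemma sq_besselJ_zero_le {x : ℝ} (hx : 1 ≤ x) : besselJ 0 x ^ 2 ≤ 8 / x := by
  -- With `f = √x J₀`, Bessel's equation reads `f'' + (1 + 1/(4x²)) f = 0`, and `E = f'² + (1 +
  -- 1/(4x²)) f²`. Only the derivative of the coefficient survives in `E'`.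
  let E : ℝ → ℝ := fun x => x * (besselJ 0 x ^ 2 + besselJ 1 x ^ 2) - besselJ 0 x * besselJ 1 x
    + besselJ 0 x ^ 2 / (2 * x)
  have hE : ∀ y : ℝ, 0 < y → HasDerivAt E (-(besselJ 0 y ^ 2 / (2 * y ^ 2))) y := by
    intro y hy
    have h0 := hasDerivAt_besselJ_zero y
    have h1 := hasDerivAt_besselJ_one hy.ne'
    have := (((hasDerivAt_id y).mul ((h0.pow 2).add (h1.pow 2))).sub (h0.mul h1)).add
      ((h0.pow 2).div ((hasDerivAt_id y).const_mul 2) (by simpa using hy.ne'))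
    refine this.congr_deriv ?_
    simp only [id, Nat.cast_ofNat, Nat.add_one_sub_one, pow_one, Pi.add_apply, Pi.pow_apply]
    field_simp
    ring
  have hanti : AntitoneOn E (Ici 1) := by
    refine antitoneOn_of_deriv_nonpos (convex_Ici 1) ?_ ?_ ?_
    · exact fun y hy => (hE y (lt_of_lt_of_le one_pos hy)).continuousAt.continuousWithinAt
    · intro y hy
      rw [interior_Ici] at hy
      exact (hE y (one_pos.trans hy)).differentiableAt.differentiableWithinAt
    · intro y hy
      rw [interior_Ici] at hy
      rw [(hE y (one_pos.trans hy)).deriv]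
      exact neg_nonpos.2 (by positivity)
  have h := hanti (mem_Ici.2 le_rfl) (mem_Ici.2 hx) hx
  have hx0 : 0 < x := one_pos.trans_le hx
  have a0 := abs_le.1 (abs_besselJ_le_one 0 1)
  have a1 := abs_le.1 (abs_besselJ_le_one 1 1)
  have p : 0 ≤ besselJ 0 x ^ 2 / (2 * x) := by positivity
  rw [le_div_iff₀ hx0]
  simp only [E] at h
  have q0 : besselJ 0 1 ^ 2 ≤ 1 := by nlinarith
  have q1 : besselJ 1 1 ^ 2 ≤ 1 := by nlinarith
  -- `E 1 ≤ 7/2`, while `J₀ J₁ ≤ (J₀² + J₁²)/2` gives `E x ≥ (x - 1/2) J₀² ≥ x J₀² / 2` for `x ≥ 1`;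
  -- so the constant 8 has room.
  nlinarith [sq_nonneg (besselJ 0 1 + besselJ 1 1), sq_nonneg (besselJ 0 x - besselJ 1 x),
    mul_nonneg (sub_nonneg.2 hx) (sq_nonneg (besselJ 1 x)),
    mul_nonneg (sub_nonneg.2 hx) (sq_nonneg (besselJ 0 x))]

/-- The bound `y^(-N/2)` is integrable at infinity exactly when `N ≥ 3`; the constant 24 exceeds
`8^(3/2)`. -/
lemma integrableOn_besselJ_zero_pow {N : ℕ} (hN : 3 ≤ N) :
    IntegrableOn (fun y => besselJ 0 y ^ N) (Ioi 0) := by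
  rw [← Ioc_union_Ioi_eq_Ioi (zero_le_one' ℝ)]
  refine IntegrableOn.union ?_ ?_
  · exact ((continuous_besselJ_zero.pow N).integrableOn_Icc).mono_set Ioc_subset_Icc_self
  · have hi : IntegrableOn (fun y : ℝ => 24 * y ^ (-(3 / 2) : ℝ)) (Ioi 1) :=
      (integrableOn_Ioi_rpow_of_lt (by norm_num) one_pos).const_mul 24
    refine hi.mono' (continuous_besselJ_zero.pow N).aestronglyMeasurable ?_
    refine (ae_restrict_mem measurableSet_Ioi).mono fun y hy => ?_
    have hy1 : 1 ≤ y := le_of_lt hy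
    have hy0 : 0 < y := one_pos.trans_le hy1
    have hb : |besselJ 0 y| ≤ (8 / y) ^ (1 / 2 : ℝ) := by
      rw [← Real.sqrt_eq_rpow]
      exact Real.abs_le_sqrt (sq_besselJ_zero_le hy1)
    calc ‖besselJ 0 y ^ N‖ = |besselJ 0 y| ^ N := by rw [norm_pow, Real.norm_eq_abs]
      _ ≤ |besselJ 0 y| ^ 3 := pow_le_pow_of_le_one (abs_nonneg _) (abs_besselJ_le_one 0 y) hN
      _ ≤ ((8 / y) ^ (1 / 2 : ℝ)) ^ 3 := by gcongr
      _ = (8 / y) ^ (3 / 2 : ℝ) := by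
        rw [← Real.rpow_natCast, ← Real.rpow_mul (by positivity)]; norm_num
      _ = 8 ^ (3 / 2 : ℝ) * y ^ (-(3 / 2) : ℝ) := by
        rw [Real.div_rpow (by norm_num) hy0.le, Real.rpow_neg hy0.le]; rfl
      _ ≤ 24 * y ^ (-(3 / 2) : ℝ) := by
        gcongr
        have : (8 : ℝ) ^ (3 / 2 : ℝ) = √(8 ^ 3) := by
          rw [Real.sqrt_eq_rpow, ← Real.rpow_natCast, ← Real.rpow_mul (by norm_num)]; norm_num
        rw [this, Real.sqrt_le_left (by norm_num)]
        norm_num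

/-! ### Averages over the circle -/

/-- Over whole periods neither the frequency nor the phase matters. Frequency 1 serves the Fourier
transform of a disc, frequency 2 the doubled angles. -/
lemma integral_comp_cos_mul_sub {g : ℝ → ℂ} (hg : Continuous g) {m : ℕ} (hm : 0 < m) (φ : ℝ) :
    ∫ θ in -Real.pi..Real.pi, g (Real.cos (m * θ - φ))
      = ∫ τ in (0 : ℝ)..Real.pi, (g (Real.sin τ) + g (-Real.sin τ)) := by
  have hper : Function.Periodic (fun θ => g (Real.cos θ)) (2 * Real.pi) := fun x => by simp
  have hm' : (m : ℝ) ≠ 0 := by positivity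
  rw [intervalIntegral.integral_comp_mul_sub (fun θ => g (Real.cos θ)) hm',
    show (m : ℝ) * Real.pi - φ = (m * -Real.pi - φ) + (m : ℤ) • (2 * Real.pi) by
      simp; ring, hper.intervalIntegral_add_zsmul_eq _ _
      (fun _ _ => Continuous.intervalIntegrable (by fun_prop) _ _),
    hper.intervalIntegral_add_eq _ (-(Real.pi / 2)), natCast_zsmul, ← Nat.cast_smul_eq_nsmul ℝ,
    smul_smul, inv_mul_cancel₀ hm', one_smul]
  have hs := intervalIntegral.integral_comp_sub_right (a := 0) (b := 2 * Real.pi)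
    (fun θ => g (Real.cos θ)) (Real.pi / 2)
  rw [show -(Real.pi / 2) + 2 * Real.pi = 2 * Real.pi - Real.pi / 2 by ring, ← zero_sub, ← hs]
  simp only [Real.cos_sub_pi_div_two]
  have hc : Continuous fun x => g (Real.sin x) := by fun_prop
  rw [← intervalIntegral.integral_add_adjacent_intervals
    (hc.intervalIntegrable 0 Real.pi) (hc.intervalIntegrable _ _),
    intervalIntegral.integral_add (hc.intervalIntegrable _ _)
    (Continuous.intervalIntegrable (by fun_prop) _ _)]
  congr 1
  have := intervalIntegral.integral_comp_add_right (a := 0) (b := Real.pi)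
    (fun θ => g (Real.sin θ)) Real.pi
  rw [zero_add, ← two_mul] at this
  rw [← this]
  simp [Real.sin_add_pi]

lemma integral_cexp_mul_cos (x : ℝ) {m : ℕ} (hm : 0 < m) (φ : ℝ) :
    ∫ θ in -Real.pi..Real.pi, Complex.exp (Complex.I * ((x * Real.cos (m * θ - φ) : ℝ) : ℂ))
      = 2 * Real.pi * besselJ 0 x := by
  rw [integral_comp_cos_mul_sub (g := fun s => Complex.exp (Complex.I * ((x * s : ℝ) : ℂ)))
    (by fun_prop) hm, besselJ_zero_eq]
  have : ∀ τ : ℝ, Complex.exp (Complex.I * ((x * Real.sin τ : ℝ) : ℂ))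
      + Complex.exp (Complex.I * ((x * -Real.sin τ : ℝ) : ℂ))
      = ((2 * Real.cos (x * Real.sin τ) : ℝ) : ℂ) := by
    intro τ
    rw [Complex.ofReal_mul 2, Complex.ofReal_cos, Complex.cos]
    push_cast
    ring_nf
  simp only [this]
  rw [intervalIntegral.integral_ofReal, intervalIntegral.integral_const_mul]
  push_cast
  field_simp [Real.pi_ne_zero]

/-! ### Gil-Pelaez inversion -/

lemma abs_sin_mul_div_le (t c : ℝ) : |Real.sin (t * c) / t| ≤ |c| := by
  rcases eq_or_ne t 0 with rfl | ht
  · simp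
  · rw [abs_div, div_le_iff₀ (abs_pos.2 ht), mul_comm, ← abs_mul, abs_le]
    exact abs_le.1 Real.abs_sin_le_abs

lemma integrableOn_exp_neg_mul {ε : ℝ} (hε : 0 < ε) :
    IntegrableOn (fun t => Real.exp (-(ε * t))) (Ioi 0) := by
  simpa only [neg_mul] using exp_neg_integrableOn_Ioi 0 hε

lemma integrableOn_sin_mul_div_mul_exp {ε : ℝ} (hε : 0 < ε) (c : ℝ) :
    IntegrableOn (fun t => Real.sin (t * c) / t * Real.exp (-(ε * t))) (Ioi 0) := by
  refine ((integrableOn_exp_neg_mul hε).const_mul |c|).mono'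
    (Measurable.aestronglyMeasurable (by fun_prop)) (.of_forall fun t => ?_)
  rw [norm_mul, Real.norm_eq_abs, Real.norm_eq_abs, Real.abs_exp]
  exact mul_le_mul_of_nonneg_right (abs_sin_mul_div_le t c) (Real.exp_nonneg _)

lemma integral_cos_mul_exp {ε : ℝ} (hε : 0 < ε) (c : ℝ) :
    ∫ t in Ioi (0 : ℝ), Real.cos (t * c) * Real.exp (-(ε * t)) = ε / (ε ^ 2 + c ^ 2) := by
  have ha : (-(ε : ℂ) + c * Complex.I).re < 0 := by simpa using hε
  have h := integral_exp_mul_complex_Ioi ha 0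
  have hi := integrableOn_exp_mul_complex_Ioi ha 0
  have h1 := congrArg Complex.re h
  rw [← RCLike.re_eq_complex_re, ← integral_re hi] at h1
  have : ∀ t : ℝ, RCLike.re (Complex.exp ((-(ε : ℂ) + c * Complex.I) * t))
      = Real.cos (t * c) * Real.exp (-(ε * t)) := by
    intro t
    rw [RCLike.re_eq_complex_re, Complex.exp_re]
    simp [mul_comm]
  simp only [this] at h1
  rw [h1]
  simp [Complex.div_re, Complex.normSq_apply]
  ring

/-- Both sides vanish at `c = 0` and have the same derivative in `c`. The damping makes Fubini
available later, and `arctan (c / ε)` tends to `(π/2) sign c` as `ε → 0`. -/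
lemma integral_sin_mul_div_mul_exp {ε : ℝ} (hε : 0 < ε) (c : ℝ) :
    ∫ t in Ioi (0 : ℝ), Real.sin (t * c) / t * Real.exp (-(ε * t)) = Real.arctan (c / ε) := by
  have hd : ∀ x : ℝ, HasDerivAt
      (fun c => ∫ t in Ioi (0 : ℝ), Real.sin (t * c) / t * Real.exp (-(ε * t)))
      (ε / (ε ^ 2 + x ^ 2)) x := by
    intro x
    rw [← integral_cos_mul_exp hε x]
    refine (hasDerivAt_integral_of_dominated_loc_of_deriv_le (s := univ) univ_mem
      (F := fun c t => Real.sin (t * c) / t * Real.exp (-(ε * t)))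
      (F' := fun c t => Real.cos (t * c) * Real.exp (-(ε * t)))
      (bound := fun t => Real.exp (-(ε * t)))
      (.of_forall fun y => Measurable.aestronglyMeasurable (by fun_prop))
      (integrableOn_sin_mul_div_mul_exp hε x) (Continuous.aestronglyMeasurable (by fun_prop))
      (.of_forall fun t y _ => ?_) (integrableOn_exp_neg_mul hε) ?_).2
    · rw [norm_mul, Real.norm_eq_abs, Real.norm_eq_abs, Real.abs_exp]
      exact mul_le_of_le_one_left (Real.exp_nonneg _) (Real.abs_cos_le_one _)
    · refine (ae_restrict_mem measurableSet_Ioi).mono fun t ht y _ => ?_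
      have ht' : t ≠ 0 := ne_of_gt ht
      refine (((((hasDerivAt_id y).const_mul t).sin).div_const t).mul_const _).congr_deriv ?_
      simp only [id]
      field_simp
  have he : ∀ x : ℝ, HasDerivAt (fun c => Real.arctan (c / ε)) (ε / (ε ^ 2 + x ^ 2)) x := by
    intro x
    refine (((hasDerivAt_id x).div_const ε).arctan).congr_deriv ?_
    simp only [id]
    field_simp
  have hz : ∀ x : ℝ, HasDerivAt (fun c => (∫ t in Ioi (0 : ℝ),
      Real.sin (t * c) / t * Real.exp (-(ε * t))) - Real.arctan (c / ε)) 0 x := fun x =>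
    ((hd x).sub (he x)).congr_deriv (sub_self _)
  have h := is_const_of_deriv_eq_zero (fun x => (hz x).differentiableAt) (fun x => (hz x).deriv) c 0
  simp only [mul_zero, Real.sin_zero, zero_div, zero_mul, integral_zero, Real.arctan_zero,
    sub_zero] at h
  linarith

section GilPelaez

variable {Ω' : Type*} [MeasurableSpace Ω'] {m : Measure Ω'} [IsProbabilityMeasure m] {Z : Ω' → ℝ}
  {K : ℝ} {φ : ℝ → ℂ}

lemma im_integral_cexp_mul (hZ : Measurable Z) (t : ℝ) :
    (∫ ω, Complex.exp (Complex.I * ((t * Z ω : ℝ) : ℂ)) ∂m).im = ∫ ω, Real.sin (t * Z ω) ∂m := by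
  have hi : Integrable (fun ω => Complex.exp (Complex.I * ((t * Z ω : ℝ) : ℂ))) m := by
    refine (integrable_const (1 : ℝ)).mono' (Measurable.aestronglyMeasurable (by fun_prop)) ?_
    exact .of_forall fun ω => by rw [mul_comm, Complex.norm_exp_ofReal_mul_I]
  rw [← RCLike.im_eq_complex_im, ← integral_im hi]
  congr 1; ext ω
  rw [RCLike.im_eq_complex_im, mul_comm, Complex.exp_ofReal_mul_I_im]

lemma measurable_integral_sin (hZ : Measurable Z) :
    Measurable fun t : ℝ => ∫ ω, Real.sin (t * Z ω) ∂m := by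
  have h : Measurable fun p : ℝ × Ω' => Real.sin (p.1 * Z p.2) := by fun_prop
  exact (h.stronglyMeasurable.integral_prod_right' (ν := m)).measurable

/-- Near 0 the bound is `|sin (tZ) / t| ≤ |Z| ≤ K`; beyond 1 the decay of `φ` leaves `C / t²`. -/
lemma integrableOn_im_div (hZ : Measurable Z) (hK : ∀ᵐ ω ∂m, |Z ω| ≤ K)
    (hφ : ∀ t, φ t = ∫ ω, Complex.exp (Complex.I * ((t * Z ω : ℝ) : ℂ)) ∂m) {C : ℝ}
    (hC : ∀ t, 0 < t → ‖φ t‖ ≤ C / t) : IntegrableOn (fun t => (φ t).im / t) (Ioi 0) := by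
  have him : ∀ t, (φ t).im = ∫ ω, Real.sin (t * Z ω) ∂m := fun t => by
    rw [hφ, im_integral_cexp_mul hZ]
  have hmeas : Measurable fun t => (φ t).im / t := by
    simp only [him]
    exact (measurable_integral_sin hZ).div measurable_id
  rw [← Ioc_union_Ioi_eq_Ioi (zero_le_one' ℝ)]
  refine IntegrableOn.union ?_ ?_
  · refine Measure.integrableOn_of_bounded (M := K) (by simp) hmeas.aestronglyMeasurable ?_
    refine .of_forall fun t => ?_
    rw [him, ← integral_div]
    refine (norm_integral_le_of_norm_le_const (C := K) (hK.mono fun ω hω => ?_)).trans ?_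
    · exact (abs_sin_mul_div_le _ _).trans hω
    · simp
  · have hi : IntegrableOn (fun y : ℝ => C * y ^ (-2 : ℝ)) (Ioi 1) :=
      (integrableOn_Ioi_rpow_of_lt (by norm_num) one_pos).const_mul C
    refine hi.mono' hmeas.aestronglyMeasurable ?_
    refine (ae_restrict_mem measurableSet_Ioi).mono fun t ht => ?_
    have ht0 : 0 < t := one_pos.trans ht
    rw [norm_div, Real.norm_eq_abs, Real.norm_eq_abs, abs_of_pos ht0, Real.rpow_neg ht0.le,
      Real.rpow_two, div_le_iff₀ ht0]
    calc |(φ t).im| ≤ ‖φ t‖ := Complex.abs_im_le_norm _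
      _ ≤ C / t := hC t ht0
      _ = _ := by field_simp

lemma integral_arctan_div (hZ : Measurable Z) (hK : ∀ᵐ ω ∂m, |Z ω| ≤ K)
    (hφ : ∀ t, φ t = ∫ ω, Complex.exp (Complex.I * ((t * Z ω : ℝ) : ℂ)) ∂m) {ε : ℝ} (hε : 0 < ε) :
    ∫ ω, Real.arctan (Z ω / ε) ∂m = ∫ t in Ioi (0 : ℝ), (φ t).im / t * Real.exp (-(ε * t)) := by
  simp only [← integral_sin_mul_div_mul_exp hε]
  rw [integral_integral_swap]
  · congr 1; ext t
    rw [integral_mul_const, integral_div, hφ, im_integral_cexp_mul hZ]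
  · have hb : Integrable (fun p : Ω' × ℝ => K * Real.exp (-(ε * p.2)))
        (m.prod (volume.restrict (Ioi 0))) :=
      ((integrableOn_exp_neg_mul hε).const_mul K).comp_snd m
    refine hb.mono' (Measurable.aestronglyMeasurable (by unfold Function.uncurry; fun_prop)) ?_
    have hK' : ∀ᵐ p ∂(m.prod (volume.restrict (Ioi (0 : ℝ)))), |Z p.1| ≤ K :=
      Measure.quasiMeasurePreserving_fst.ae hK
    filter_upwards [hK'] with p hp
    rw [Function.uncurry_def, norm_mul, Real.norm_eq_abs, Real.norm_eq_abs, Real.abs_exp]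
    gcongr
    exact (abs_sin_mul_div_le _ _).trans hp

/-- Dominated convergence in `integral_arctan_div` along `ε = 1/(n+1)`: the left side tends to the
mean of `(π/2) sign Z`, and the damping disappears on the right. -/
lemma measureReal_pos_sub_measureReal_neg (hZ : Measurable Z) (hK : ∀ᵐ ω ∂m, |Z ω| ≤ K)
    (hφ : ∀ t, φ t = ∫ ω, Complex.exp (Complex.I * ((t * Z ω : ℝ) : ℂ)) ∂m)
    (hint : IntegrableOn (fun t => (φ t).im / t) (Ioi 0)) :
    m.real {ω | 0 < Z ω} - m.real {ω | Z ω < 0}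
      = 2 / Real.pi * ∫ t in Ioi (0 : ℝ), (φ t).im / t := by
  have hn : ∀ n : ℕ, (0 : ℝ) < 1 / ((n : ℝ) + 1) := fun n => by positivity
  have hlim : Tendsto (fun n : ℕ => (1 : ℝ) / ((n : ℝ) + 1)) atTop (𝓝 0) :=
    tendsto_one_div_add_atTop_nhds_zero_nat
  have hR : Tendsto (fun n : ℕ => ∫ t in Ioi (0 : ℝ),
      (φ t).im / t * Real.exp (-(1 / ((n : ℝ) + 1) * t))) atTop
      (𝓝 (∫ t in Ioi (0 : ℝ), (φ t).im / t)) := by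
    refine tendsto_integral_of_dominated_convergence (fun t => ‖(φ t).im / t‖)
      (fun n => hint.1.mul (Continuous.aestronglyMeasurable (by fun_prop))) hint.norm
      (fun n => ?_) (.of_forall fun t => ?_)
    · refine (ae_restrict_mem measurableSet_Ioi).mono fun t ht => ?_
      rw [norm_mul]
      refine mul_le_of_le_one_right (norm_nonneg _) ?_
      rw [Real.norm_eq_abs, Real.abs_exp, Real.exp_le_one_iff, neg_nonpos]
      exact mul_nonneg (hn n).le (le_of_lt ht)
    · have : Tendsto (fun n : ℕ => (φ t).im / t * Real.exp (-(1 / ((n : ℝ) + 1) * t))) atTop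
          (𝓝 ((φ t).im / t * Real.exp (-(0 * t)))) :=
        ((Real.continuous_exp.tendsto _).comp (hlim.mul_const t).neg).const_mul _
      simpa using this
  have hL : Tendsto (fun n : ℕ => ∫ ω, Real.arctan (Z ω / (1 / ((n : ℝ) + 1))) ∂m) atTop
      (𝓝 (∫ ω, Real.pi / 2 * ({ω | 0 < Z ω}.indicator 1 ω - {ω | Z ω < 0}.indicator 1 ω) ∂m)) := by
    have hat : Tendsto (fun n : ℕ => (n : ℝ) + 1) atTop atTop :=
      tendsto_natCast_atTop_atTop.atTop_add tendsto_const_nhds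
    refine tendsto_integral_of_dominated_convergence (fun _ => Real.pi / 2)
      (fun n => Measurable.aestronglyMeasurable (by fun_prop)) (integrable_const _)
      (fun n => .of_forall fun ω => ?_) (.of_forall fun ω => ?_)
    · exact abs_le.2 ⟨(Real.neg_pi_div_two_lt_arctan _).le, (Real.arctan_lt_pi_div_two _).le⟩
    · simp only [div_div_eq_mul_div, div_one]
      rcases lt_trichotomy (Z ω) 0 with h | h | h
      · rw [indicator_of_notMem (by simpa using h.le), indicator_of_mem (by simpa using h)]
        have := (tendsto_nhds_of_tendsto_nhdsWithin Real.tendsto_arctan_atBot).comp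
          (hat.const_mul_atTop_of_neg h)
        simpa [Function.comp_def] using this
      · simp [h]
      · rw [indicator_of_mem (by simpa using h), indicator_of_notMem (by simpa using h.le)]
        have := (tendsto_nhds_of_tendsto_nhdsWithin Real.tendsto_arctan_atTop).comp
          (hat.const_mul_atTop h)
        simpa [Function.comp_def] using this
  simp only [integral_arctan_div hZ hK hφ (hn _)] at hL
  have h := tendsto_nhds_unique hL hR
  have m1 : MeasurableSet {ω | 0 < Z ω} := measurableSet_lt measurable_const hZ
  have m2 : MeasurableSet {ω | Z ω < 0} := measurableSet_lt hZ measurable_const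
  rw [integral_const_mul, integral_sub ((integrable_const 1).indicator m1)
    ((integrable_const 1).indicator m2), integral_indicator_one m1, integral_indicator_one m2] at h
  rw [← h]
  field_simp [Real.pi_ne_zero]

lemma measureReal_pos_eq (hZ : Measurable Z) (hK : ∀ᵐ ω ∂m, |Z ω| ≤ K)
    (hφ : ∀ t, φ t = ∫ ω, Complex.exp (Complex.I * ((t * Z ω : ℝ) : ℂ)) ∂m)
    (hint : IntegrableOn (fun t => (φ t).im / t) (Ioi 0)) (h0 : ∀ᵐ ω ∂m, Z ω ≠ 0) :
    m.real {ω | 0 < Z ω} = 1 / 2 + 1 / Real.pi * ∫ t in Ioi (0 : ℝ), (φ t).im / t := by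
  have h := measureReal_pos_sub_measureReal_neg hZ hK hφ hint
  have m1 : MeasurableSet {ω | 0 < Z ω} := measurableSet_lt measurable_const hZ
  have hc : m.real {ω | Z ω < 0} = 1 - m.real {ω | 0 < Z ω} := by
    rw [← probReal_compl_eq_one_sub m1]
    refine measureReal_congr ?_
    filter_upwards [h0] with ω hω
    refine propext ⟨fun h : Z ω < 0 => ?_, fun h => ?_⟩
    · exact fun h' : 0 < Z ω => lt_asymm h h'
    · exact lt_of_le_of_ne (not_lt.1 h) hω
  rw [hc] at h
  rw [show (2 : ℝ) / Real.pi = 2 * (1 / Real.pi) by ring] at h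
  linarith

end GilPelaez

/-! ### Sine and cosine integrals, and the closed form of `phiA` -/

/-- `sin t / t` has the default value 0 at `t = 0` where `sinc` is 1; the point is null, and `sinc`
is continuous. -/
lemma Si_eq_integral_sinc : Si = fun x => ∫ t in (0 : ℝ)..x, Real.sinc t := by
  ext x
  refine intervalIntegral.integral_congr_ae ?_
  have : ∀ᵐ t : ℝ, t ≠ 0 := by simp [ae_iff]
  exact this.mono fun t ht _ => (Real.sinc_of_ne_zero ht).symm

lemma hasDerivAt_Si {x : ℝ} (hx : x ≠ 0) : HasDerivAt Si (Real.sin x / x) x := by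
  rw [Si_eq_integral_sinc, ← Real.sinc_of_ne_zero hx]
  exact intervalIntegral.integral_hasDerivAt_right (Real.continuous_sinc.intervalIntegrable _ _)
    (Real.continuous_sinc.stronglyMeasurableAtFilter _ _) Real.continuous_sinc.continuousAt

lemma intervalIntegrable_cos_div {a b : ℝ} (ha : 0 < a) (hb : 0 < b) :
    IntervalIntegrable (fun t => Real.cos t / t) volume a b := by
  refine ContinuousOn.intervalIntegrable (Real.continuous_cos.continuousOn.div continuousOn_id ?_)
  intro t ht
  exact ((lt_min ha hb).trans_le ht.1).ne'

/-- One integration by parts trades `cos t / t` for the absolutely integrable `sin t / t²`. -/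
lemma exists_tendsto_integral_cos_div :
    ∃ L : ℝ, Tendsto (fun b : ℝ => ∫ t in (1 : ℝ)..b, Real.cos t / t) atTop (𝓝 L) := by
  have hi : IntegrableOn (fun t : ℝ => Real.sin t * (t ^ 2)⁻¹) (Ioi 1) := by
    have h2 : IntegrableOn (fun y : ℝ => y ^ (-2 : ℝ)) (Ioi 1) :=
      integrableOn_Ioi_rpow_of_lt (by norm_num) one_pos
    refine h2.mono' (Measurable.aestronglyMeasurable (by fun_prop)) ?_
    refine (ae_restrict_mem measurableSet_Ioi).mono fun t ht => ?_
    have ht0 : 0 < t := one_pos.trans ht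
    rw [Real.rpow_neg ht0.le, Real.rpow_two, norm_mul, Real.norm_eq_abs, Real.norm_eq_abs,
      abs_of_pos (a := (t ^ 2)⁻¹) (by positivity)]
    exact mul_le_of_le_one_left (by positivity) (Real.abs_sin_le_one t)
  have ht := intervalIntegral_tendsto_integral_Ioi 1 hi tendsto_id
  have hs : Tendsto (fun b : ℝ => Real.sin b * b⁻¹) atTop (𝓝 0) := by
    refine squeeze_zero_norm' ?_ tendsto_inv_atTop_zero
    filter_upwards [eventually_gt_atTop 0] with b hb
    rw [norm_mul, Real.norm_eq_abs, Real.norm_eq_abs, abs_of_pos (inv_pos.2 hb)]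
    exact mul_le_of_le_one_left (by positivity) (Real.abs_sin_le_one b)
  refine ⟨_, ((hs.sub_const (Real.sin 1 * 1⁻¹)).add ht).congr' ?_⟩
  filter_upwards [eventually_ge_atTop 1] with b hb
  have hne : ∀ t ∈ uIcc 1 b, t ≠ 0 := fun t ht => by
    rw [uIcc_of_le hb] at ht
    exact (one_pos.trans_le ht.1).ne'
  have hp := intervalIntegral.integral_mul_deriv_eq_deriv_mul (a := 1) (b := b)
    (u := fun t => t⁻¹) (v := Real.sin) (u' := fun t => -(t ^ 2)⁻¹) (v' := Real.cos)
    (fun t ht => hasDerivAt_inv (hne t ht)) (fun t _ => Real.hasDerivAt_sin t)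
    (ContinuousOn.intervalIntegrable (((continuousOn_id.pow 2).inv₀
      (fun t ht => pow_ne_zero 2 (hne t ht))).neg))
    (Continuous.intervalIntegrable (by fun_prop) _ _)
  have e1 : ∫ t in (1 : ℝ)..b, Real.cos t / t = ∫ t in (1 : ℝ)..b, t⁻¹ * Real.cos t := by
    simp only [div_eq_mul_inv, mul_comm]
  rw [e1, hp]
  simp only [neg_mul, intervalIntegral.integral_neg, sub_neg_eq_add, id, mul_comm]

/-- Trades the improper limit for a proper integral plus a constant. The constant is never needed,
since only the derivative of `Ci` is used. -/
lemma exists_Ci_eq : ∃ L : ℝ, ∀ x : ℝ, x ≠ 0 →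
    Ci x = L + ∫ t in (1 : ℝ)..|x|, Real.cos t / t := by
  obtain ⟨L, hL⟩ := exists_tendsto_integral_cos_div
  refine ⟨-L, fun x hx => ?_⟩
  have hx' := abs_pos.2 hx
  have : Tendsto (fun b : ℝ => ∫ t in |x|..b, Real.cos t / t) atTop
      (𝓝 (L - ∫ t in (1 : ℝ)..|x|, Real.cos t / t)) := by
    refine (hL.sub_const (∫ t in (1 : ℝ)..|x|, Real.cos t / t)).congr' ?_
    filter_upwards [eventually_gt_atTop 0] with b hb
    exact intervalIntegral.integral_interval_sub_left (intervalIntegrable_cos_div one_pos hb)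
      (intervalIntegrable_cos_div one_pos hx')
  rw [Ci, this.limUnder_eq]
  ring

lemma hasDerivAt_Ci {x : ℝ} (hx : x ≠ 0) : HasDerivAt Ci (Real.cos x / x) x := by
  obtain ⟨L, hL⟩ := exists_Ci_eq
  have hpos : ∀ y : ℝ, 0 < y →
      HasDerivAt (fun y => L + ∫ t in (1 : ℝ)..y, Real.cos t / t) (Real.cos y / y) y := by
    intro y hy
    have hc : ContinuousAt (fun t => Real.cos t / t) y :=
      Real.continuous_cos.continuousAt.div continuousAt_id hy.ne'
    refine (intervalIntegral.integral_hasDerivAt_right (intervalIntegrable_cos_div one_pos hy)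
      (Measurable.stronglyMeasurable (by fun_prop)).stronglyMeasurableAtFilter hc).const_add L
  rcases lt_or_gt_of_ne hx with h | h
  · have hc := (hpos (-x) (neg_pos.2 h)).comp x (hasDerivAt_neg x)
    refine (hc.congr_of_eventuallyEq ?_).congr_deriv ?_
    · filter_upwards [eventually_lt_nhds h] with y hy
      rw [hL y hy.ne, abs_of_neg hy]; rfl
    · rw [Real.cos_neg]; field_simp
  · refine (hpos x h).congr_of_eventuallyEq ?_
    filter_upwards [eventually_gt_nhds h] with y hy
    rw [hL y hy.ne', abs_of_pos hy]

lemma hasDerivAt_H {x : ℝ} (hx : x ≠ 0) :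
    HasDerivAt H (-Complex.I * Complex.exp (Complex.I * x) / x) x := by
  refine ((hasDerivAt_Si hx).ofReal_comp.sub
    ((hasDerivAt_Ci hx).ofReal_comp.const_mul Complex.I)).congr_deriv ?_
  rw [mul_comm Complex.I (x : ℂ), Complex.exp_mul_I]
  push_cast
  ring_nf
  rw [Complex.I_sq]
  ring

lemma hasDerivAt_cexp_I_mul_div (t : ℝ) {s : ℝ} (hs : s ≠ 0) :
    HasDerivAt (fun s : ℝ => Complex.exp (Complex.I * ((t / s : ℝ) : ℂ)))
      (-(Complex.I * (t / s ^ 2)) * Complex.exp (Complex.I * ((t / s : ℝ) : ℂ))) s := by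
  have h : HasDerivAt (fun s : ℝ => t / s) (-(t / s ^ 2)) s :=
    ((hasDerivAt_inv hs).const_mul t).congr_deriv (by field_simp)
  refine ((h.ofReal_comp.const_mul Complex.I).cexp).congr_deriv ?_
  push_cast
  ring

lemma continuousOn_cexp_I_mul_div (t : ℝ) {a b : ℝ} (ha : 0 < a) (hb : 0 < b) :
    ContinuousOn (fun s : ℝ => Complex.exp (Complex.I * ((t / s : ℝ) : ℂ))) (uIcc a b) :=
  fun _ hs => (hasDerivAt_cexp_I_mul_div t
    ((lt_min ha hb).trans_le hs.1).ne').continuousAt.continuousWithinAt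

/-- `s exp (it/s) + t H(t/s)` is an antiderivative of `exp (it/s)`: the derivative of the `H` term
cancels the extra `-(it/s) exp (it/s)` of the product rule. -/
lemma phiA_eq_integral {a b : ℝ} (ha : 0 < a) (hab : a < b) (t : ℝ) :
    phiA a b t = 1 / ((b : ℂ) ^ 2 - (a : ℂ) ^ 2) *
      ∫ s in a ^ 2..b ^ 2, Complex.exp (Complex.I * ((t / s : ℝ) : ℂ)) := by
  have hb := ha.trans hab
  rcases eq_or_ne t 0 with rfl | ht
  · simp [phiA]
  · have hd : ∀ s ∈ uIcc (a ^ 2) (b ^ 2), HasDerivAt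
        (fun s : ℝ => (s : ℂ) * Complex.exp (Complex.I * ((t / s : ℝ) : ℂ)) + t * H (t / s))
        (Complex.exp (Complex.I * ((t / s : ℝ) : ℂ))) s := by
      intro s hs
      have hs0 : s ≠ 0 := ((lt_min (pow_pos ha 2) (pow_pos hb 2)).trans_le hs.1).ne'
      have h : HasDerivAt (fun s : ℝ => t / s) (-(t / s ^ 2)) s :=
        ((hasDerivAt_inv hs0).const_mul t).congr_deriv (by field_simp)
      have hH := (hasDerivAt_H (div_ne_zero ht hs0)).scomp s h
      refine (((hasDerivAt_id s).ofReal_comp.mul (hasDerivAt_cexp_I_mul_div t hs0)).add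
        (hH.const_mul (t : ℂ))).congr_deriv ?_
      have hs' : (s : ℂ) ≠ 0 := by exact_mod_cast hs0
      have ht' : (t : ℂ) ≠ 0 := by exact_mod_cast ht
      simp only [id, Complex.real_smul]
      push_cast
      field_simp
      ring
    rw [intervalIntegral.integral_eq_sub_of_hasDerivAt hd
      (continuousOn_cexp_I_mul_div t (pow_pos ha 2) (pow_pos hb 2)).intervalIntegrable, phiA]
    push_cast
    ring

/-- Integration by parts: `exp (it/s)` is the derivative of `(i/t) s² exp (it/s)` minus `(i/t) 2s
exp (it/s)`, and everything carries a factor `1/t`. The boundary terms and the remaining integral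
add up to `b⁴ + a⁴ + (b⁴ - a⁴) = 2b⁴`. -/
lemma norm_phiA_le {a b : ℝ} (ha : 0 < a) (hab : a < b) {t : ℝ} (ht : t ≠ 0) :
    ‖phiA a b t‖ ≤ 2 * b ^ 4 / (b ^ 2 - a ^ 2) / |t| := by
  have hb := ha.trans hab
  have hab2 : a ^ 2 < b ^ 2 := by gcongr
  have hne : ∀ s ∈ uIcc (a ^ 2) (b ^ 2), s ≠ 0 := fun s hs =>
    ((lt_min (pow_pos ha 2) (pow_pos hb 2)).trans_le hs.1).ne'
  have ht' : (t : ℂ) ≠ 0 := by exact_mod_cast ht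
  set e : ℝ → ℂ := fun s => Complex.exp (Complex.I * ((t / s : ℝ) : ℂ)) with he
  have hn : ∀ s, ‖e s‖ = 1 := fun s => by
    simp only [he]
    rw [mul_comm, Complex.norm_exp_ofReal_mul_I]
  have hec : ContinuousOn e (uIcc (a ^ 2) (b ^ 2)) :=
    continuousOn_cexp_I_mul_div t (pow_pos ha 2) (pow_pos hb 2)
  have hd : ∀ s ∈ uIcc (a ^ 2) (b ^ 2), HasDerivAt (fun s : ℝ => Complex.I / t * (s ^ 2 : ℝ) * e s)
      (e s + Complex.I / t * ((2 * s : ℝ) * e s)) s := by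
    intro s hs
    have hs' : (s : ℂ) ≠ 0 := by exact_mod_cast hne s hs
    refine ((((hasDerivAt_pow 2 s).ofReal_comp.const_mul (Complex.I / t))).mul
      (hasDerivAt_cexp_I_mul_div t (hne s hs))).congr_deriv ?_
    simp only [he]
    push_cast
    field_simp
    ring_nf
    rw [Complex.I_sq]
    ring
  have hc2 : ContinuousOn (fun s : ℝ => ((2 * s : ℝ) : ℂ) * e s) (uIcc (a ^ 2) (b ^ 2)) :=
    (Continuous.continuousOn (by fun_prop)).mul hec
  have hc3 : ContinuousOn (fun s : ℝ => Complex.I / t * (((2 * s : ℝ) : ℂ) * e s))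
    (uIcc (a ^ 2) (b ^ 2)) := continuousOn_const.mul hc2
  have hp := intervalIntegral.integral_eq_sub_of_hasDerivAt hd (hec.add hc3).intervalIntegrable
  rw [intervalIntegral.integral_add hec.intervalIntegrable hc3.intervalIntegrable,
    intervalIntegral.integral_const_mul] at hp
  have h2 : ‖∫ s in a ^ 2..b ^ 2, ((2 * s : ℝ) : ℂ) * e s‖ ≤ b ^ 4 - a ^ 4 := by
    refine (intervalIntegral.norm_integral_le_of_norm_le hab2.le (g := fun s => 2 * s)
      (.of_forall fun s hs => ?_) (Continuous.intervalIntegrable (by fun_prop) _ _)).trans_eq ?_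
    · rw [norm_mul, hn, mul_one, Complex.norm_real, Real.norm_eq_abs, abs_of_nonneg]
      have := (pow_pos ha 2).trans hs.1
      positivity
    · rw [intervalIntegral.integral_const_mul, integral_id]
      ring
  have hI : ‖Complex.I / (t : ℂ)‖ = 1 / |t| := by simp
  have hE : ‖∫ s in a ^ 2..b ^ 2, e s‖ ≤ 2 * b ^ 4 / |t| := by
    rw [eq_sub_of_add_eq hp]
    refine (norm_sub_le _ _).trans ((add_le_add (norm_sub_le _ _) le_rfl).trans ?_)
    simp only [norm_mul, hn, hI, mul_one, Complex.norm_real, norm_pow, Real.norm_eq_abs,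
      abs_of_pos ha, abs_of_pos hb]
    calc _ ≤ 1 / |t| * (b ^ 2) ^ 2 + 1 / |t| * (a ^ 2) ^ 2 + 1 / |t| * (b ^ 4 - a ^ 4) := by gcongr
      _ = _ := by ring
  have hD : ‖(1 : ℂ) / ((b : ℂ) ^ 2 - (a : ℂ) ^ 2)‖ = 1 / (b ^ 2 - a ^ 2) := by
    rw [← Complex.ofReal_pow, ← Complex.ofReal_pow, ← Complex.ofReal_sub, norm_div, norm_one,
      Complex.norm_real, Real.norm_eq_abs, abs_of_pos (sub_pos.2 hab2)]
  rw [phiA_eq_integral ha hab, norm_mul, hD]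
  calc _ ≤ 1 / (b ^ 2 - a ^ 2) * (2 * b ^ 4 / |t|) := by
        have := sub_pos.2 hab2
        gcongr
    _ = _ := by ring

/-! ### Polar coordinates of a uniform point of an annulus -/

/-- The law of the polar radius of a uniform point of the annulus. -/
noncomputable def radLaw (a b : ℝ) : Measure ℝ :=
  (ENNReal.ofReal ((b ^ 2 - a ^ 2) / 2))⁻¹ •
    (volume.restrict (Icc a b)).withDensity fun r => ENNReal.ofReal r

/-- The law of the argument of a uniform point of the annulus. -/
noncomputable def angLaw : Measure ℝ :=
  (ENNReal.ofReal (2 * Real.pi))⁻¹ • volume.restrict (Ioo (-Real.pi) Real.pi)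

lemma measurableSet_annulus (a b : ℝ) : MeasurableSet (annulus a b) :=
  (measurableSet_le measurable_const measurable_norm).inter
    (measurableSet_le measurable_norm measurable_const)

/-- Checked on rectangles, by the polar change of variables: the Jacobian `r` becomes the radial
density, and the annulus constrains the radius only. -/
lemma map_norm_arg_restrict_annulus {a : ℝ} (ha : 0 < a) (b : ℝ) :
    (volume.restrict (annulus a b)).map (fun z : ℂ => (‖z‖, z.arg)) =
      ((volume.restrict (Icc a b)).withDensity fun r => ENNReal.ofReal r).prod
        (volume.restrict (Ioo (-Real.pi) Real.pi)) := by
  have hm : Measurable fun z : ℂ => (‖z‖, z.arg) := measurable_norm.prodMk Complex.measurable_arg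
  have : SigmaFinite ((volume.restrict (Icc a b)).withDensity fun r => ENNReal.ofReal r) :=
    SigmaFinite.withDensity_of_ne_top (.of_forall fun _ => ENNReal.ofReal_ne_top)
  refine (Measure.prod_eq fun s t hs ht => ?_).symm
  have hst := hm (hs.prod ht)
  rw [Measure.map_apply hm (hs.prod ht), Measure.restrict_apply hst,
    ← lintegral_indicator_one (hst.inter (measurableSet_annulus a b)),
    ← Complex.lintegral_comp_polarCoord_symm, polarCoord_target, Measure.volume_eq_prod,
    ← Measure.prod_restrict]
  have e : ∀ p ∈ Ioi (0 : ℝ) ×ˢ Ioo (-Real.pi) Real.pi, ENNReal.ofReal p.1 •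
      ((fun z : ℂ => (‖z‖, z.arg)) ⁻¹' s ×ˢ t ∩ annulus a b).indicator (1 : ℂ → ENNReal)
        (Complex.polarCoord.symm p)
      = (s ∩ Icc a b).indicator (fun r => ENNReal.ofReal r) p.1 * t.indicator 1 p.2 := by
    rintro ⟨r, θ⟩ hp
    have h1 : (‖Complex.polarCoord.symm (r, θ)‖, (Complex.polarCoord.symm (r, θ)).arg) = (r, θ) := by
      rw [← Complex.polarCoord_apply]
      exact Complex.polarCoord.right_inv hp
    have hn := congrArg Prod.fst h1
    have hg := congrArg Prod.snd h1
    simp only at hn hg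
    have hmem : Complex.polarCoord.symm (r, θ) ∈ (fun z : ℂ => (‖z‖, z.arg)) ⁻¹' s ×ˢ t ∩
        annulus a b ↔ (r ∈ s ∧ θ ∈ t) ∧ (a ≤ r ∧ r ≤ b) := by
      change ((‖_‖ ∈ s ∧ Complex.arg _ ∈ t) ∧ (a ≤ ‖_‖ ∧ ‖_‖ ≤ b)) ↔ _
      rw [hn, hg]
    have hmem' : r ∈ s ∩ Icc a b ↔ r ∈ s ∧ (a ≤ r ∧ r ≤ b) := Iff.rfl
    by_cases h1 : r ∈ s ∧ (a ≤ r ∧ r ≤ b)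
    · rw [indicator_of_mem (hmem'.2 h1)]
      by_cases h2 : θ ∈ t
      · rw [indicator_of_mem (hmem.2 ⟨⟨h1.1, h2⟩, h1.2⟩), indicator_of_mem h2]
        rfl
      · rw [indicator_of_notMem (fun h => h2 (hmem.1 h).1.2), indicator_of_notMem h2, smul_zero,
          mul_zero]
    · rw [indicator_of_notMem (fun h => h1 ⟨(hmem.1 h).1.1, (hmem.1 h).2⟩),
        indicator_of_notMem (fun h => h1 (hmem'.1 h)), smul_zero, zero_mul]
  rw [Measure.prod_restrict, setLIntegral_congr_fun (measurableSet_Ioi.prod measurableSet_Ioo) e,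
    ← Measure.prod_restrict, lintegral_prod_mul
      ((by fun_prop : Measurable fun r : ℝ => ENNReal.ofReal r).indicator
        (hs.inter measurableSet_Icc)).aemeasurable
      (measurable_one.indicator ht).aemeasurable, lintegral_indicator_one ht,
    lintegral_indicator (hs.inter measurableSet_Icc), withDensity_apply _ hs,
    Measure.restrict_restrict (hs.inter measurableSet_Icc), Measure.restrict_restrict hs]
  congr 3
  rw [inter_eq_left]
  exact fun r hr => ha.trans_le hr.2.1

lemma lintegral_Icc_ofReal_id {a b : ℝ} (ha : 0 < a) (hab : a < b) :
    ∫⁻ r in Icc a b, ENNReal.ofReal r = ENNReal.ofReal ((b ^ 2 - a ^ 2) / 2) := by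
  rw [← ofReal_integral_eq_lintegral_ofReal]
  · rw [integral_Icc_eq_integral_Ioc, ← intervalIntegral.integral_of_le hab.le, integral_id]
  · exact continuous_id.integrableOn_Icc
  · exact (ae_restrict_mem measurableSet_Icc).mono fun r hr => ha.le.trans hr.1

lemma volume_annulus {a b : ℝ} (ha : 0 < a) (hab : a < b) : volume (annulus a b) =
    ENNReal.ofReal ((b ^ 2 - a ^ 2) / 2) * ENNReal.ofReal (2 * Real.pi) := by
  have h := congrArg (fun ν => ν univ) (map_norm_arg_restrict_annulus ha b)
  have hm : Measurable fun z : ℂ => (‖z‖, z.arg) := measurable_norm.prodMk Complex.measurable_arg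
  simp only [Measure.map_apply hm .univ, preimage_univ, Measure.restrict_apply_univ] at h
  rw [h, ← univ_prod_univ, Measure.prod_prod, withDensity_apply _ .univ, Measure.restrict_univ,
    lintegral_Icc_ofReal_id ha hab]
  simp [two_mul]

lemma map_norm_arg_cond_annulus {a b : ℝ} (ha : 0 < a) (hab : a < b) :
    (cond volume (annulus a b)).map (fun z : ℂ => (‖z‖, z.arg)) = (radLaw a b).prod angLaw := by
  have hpos : 0 < (b ^ 2 - a ^ 2) / 2 := by
    have : a ^ 2 < b ^ 2 := by gcongr
    linarith
  rw [ProbabilityTheory.cond, Measure.map_smul, map_norm_arg_restrict_annulus ha,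
    volume_annulus ha hab, radLaw, angLaw, Measure.prod_smul_left, Measure.prod_smul_right,
    smul_smul, ENNReal.mul_inv (by simp [hpos]) (by simp)]

lemma isProbabilityMeasure_radLaw {a b : ℝ} (ha : 0 < a) (hab : a < b) :
    IsProbabilityMeasure (radLaw a b) := by
  have hpos : 0 < (b ^ 2 - a ^ 2) / 2 := by
    have : a ^ 2 < b ^ 2 := by gcongr
    linarith
  constructor
  rw [radLaw, Measure.smul_apply, withDensity_apply _ .univ, Measure.restrict_univ,
    lintegral_Icc_ofReal_id ha hab, smul_eq_mul, ENNReal.inv_mul_cancel (by simp [hpos]) (by simp)]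

instance : IsProbabilityMeasure angLaw := by
  constructor
  rw [angLaw, Measure.smul_apply, Measure.restrict_apply_univ, Real.volume_Ioo, smul_eq_mul,
    sub_neg_eq_add, ← two_mul,
    ENNReal.inv_mul_cancel (by simp [Real.pi_pos]) ENNReal.ofReal_ne_top]

lemma radLaw_absolutelyContinuous (a b : ℝ) : radLaw a b ≪ volume :=
  ((withDensity_absolutelyContinuous _ _).trans Measure.absolutelyContinuous_restrict).smul_left _

lemma angLaw_absolutelyContinuous : angLaw ≪ volume :=
  Measure.absolutelyContinuous_restrict.smul_left _

lemma ae_radLaw_mem_Icc (a b : ℝ) : ∀ᵐ r ∂radLaw a b, r ∈ Icc a b :=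
  ((withDensity_absolutelyContinuous _ _).smul_left _).ae_le (ae_restrict_mem measurableSet_Icc)

lemma integral_radLaw {a b : ℝ} (ha : 0 < a) (hab : a < b) (f : ℝ → ℂ) :
    ∫ r, f r ∂radLaw a b = 1 / ((b : ℂ) ^ 2 - (a : ℂ) ^ 2) *
      ∫ r in a..b, (2 * r : ℝ) • f r := by
  have hpos : 0 < (b ^ 2 - a ^ 2) / 2 := by
    have : a ^ 2 < b ^ 2 := by gcongr
    linarith
  rw [radLaw, integral_smul_measure, integral_withDensity_eq_integral_toReal_smul (by fun_prop)
    (.of_forall fun _ => ENNReal.ofReal_lt_top), intervalIntegral.integral_of_le hab.le,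
    ← integral_Icc_eq_integral_Ioc, ENNReal.toReal_inv, ENNReal.toReal_ofReal hpos.le]
  have e : ∀ r ∈ Icc a b, (ENNReal.ofReal r).toReal • f r = (1 / 2 : ℝ) • ((2 * r : ℝ) • f r) := by
    intro r hr
    rw [ENNReal.toReal_ofReal (ha.le.trans hr.1), smul_smul]
    congr 1; ring
  rw [setIntegral_congr_fun measurableSet_Icc e, integral_smul, smul_smul, Complex.real_smul]
  congr 1
  push_cast
  field_simp

lemma integral_angLaw {E : Type*} [NormedAddCommGroup E] [NormedSpace ℝ E] (f : ℝ → E) :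
    ∫ θ, f θ ∂angLaw = (2 * Real.pi)⁻¹ • ∫ θ in -Real.pi..Real.pi, f θ := by
  rw [angLaw, integral_smul_measure, intervalIntegral.integral_of_le (by linarith [Real.pi_pos]),
    integral_Ioc_eq_integral_Ioo, ENNReal.toReal_inv, ENNReal.toReal_ofReal (by positivity)]

/-- The substitution `s = r²` absorbs the density `2r`: the squared radius is uniform. -/
lemma integral_radLaw_cexp {a b : ℝ} (ha : 0 < a) (hab : a < b) (t : ℝ) :
    ∫ r, Complex.exp (Complex.I * ((t * (r ^ 2)⁻¹ : ℝ) : ℂ)) ∂radLaw a b = phiA a b t := by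
  rw [integral_radLaw ha hab, phiA_eq_integral ha hab]
  congr 1
  have hb := ha.trans hab
  have h := intervalIntegral.integral_deriv_smul_comp'' (a := a) (b := b) (f := fun r => r ^ 2)
    (f' := fun r => 2 * r) (g := fun s : ℝ => Complex.exp (Complex.I * ((t / s : ℝ) : ℂ)))
    (by fun_prop)
    (fun r _ => by simpa using (hasDerivAt_pow 2 r).hasDerivWithinAt) (by fun_prop)
    (fun s hs => by
      obtain ⟨r, hr, rfl⟩ := hs
      rw [uIcc_of_le hab.le] at hr
      exact (hasDerivAt_cexp_I_mul_div t
        (pow_pos (ha.trans_le hr.1) 2).ne').continuousAt.continuousWithinAt)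
  rw [← h]
  rfl

/-! ### The joint law of the anchors -/

/-- By Fubini: for each value `v`, equality confines `U` to the single point `f v`, which is not an
atom. This excludes ties between angles, atoms of sums, and ties in the final ccdf. -/
lemma ae_ne_of_indepFun {Ω β : Type*} [MeasurableSpace Ω] [MeasurableSpace β] {μ : Measure Ω}
    [IsProbabilityMeasure μ] {U : Ω → ℝ} {V : Ω → β} (hU : Measurable U) (hV : Measurable V)
    (h : IndepFun U V μ) (h0 : ∀ x, ∀ᵐ ω ∂μ, U ω ≠ x) {f : β → ℝ} (hf : Measurable f) :
    ∀ᵐ ω ∂μ, U ω ≠ f (V ω) := by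
  have hm := (indepFun_iff_map_prod_eq_prod_map_map hU.aemeasurable hV.aemeasurable).1 h
  have hs : MeasurableSet {p : ℝ × β | p.1 = f p.2} :=
    measurableSet_eq_fun measurable_fst (hf.comp measurable_snd)
  have := Measure.isProbabilityMeasure_map (μ := μ) hU.aemeasurable
  have := Measure.isProbabilityMeasure_map (μ := μ) hV.aemeasurable
  have h1 : μ.map (fun ω => (U ω, V ω)) {p | p.1 = f p.2} = 0 := by
    rw [hm, Measure.prod_apply_symm hs]
    simp only [lintegral_eq_zero_iff (measurable_measure_prodMk_right hs)]
    refine .of_forall fun v => ?_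
    have : (fun x : ℝ => (x, v)) ⁻¹' {p : ℝ × β | p.1 = f p.2} = {f v} := by ext; simp
    beta_reduce
    rw [this, Measure.map_apply hU (measurableSet_singleton _)]
    have h0' := h0 (f v)
    rw [ae_iff] at h0'
    simpa only [ne_eq, not_not] using! h0'
  rw [Measure.map_apply (hU.prodMk hV) hs] at h1
  rw [ae_iff]
  simpa using h1

section Law

variable {Ω : Type*} [MeasurableSpace Ω] {μ : Measure Ω} [IsProbabilityMeasure μ] {N : ℕ}
  {P : Fin N → Ω → ℂ} {a b : ℝ}

lemma IsBPP.map_norm_arg (hP : IsBPP μ P (annulus a b)) (ha : 0 < a) (hab : a < b) (k : Fin N) :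
    μ.map (fun ω => (‖P k ω‖, (P k ω).arg)) = (radLaw a b).prod angLaw := by
  have hm : Measurable fun z : ℂ => (‖z‖, z.arg) := measurable_norm.prodMk Complex.measurable_arg
  rw [← map_norm_arg_cond_annulus ha hab, ← hP.uniform k, Measure.map_map hm (hP.measurable k)]
  rfl

lemma IsBPP.map_norm (hP : IsBPP μ P (annulus a b)) (ha : 0 < a) (hab : a < b) (k : Fin N) :
    μ.map (fun ω => ‖P k ω‖) = radLaw a b := by
  have hm : Measurable fun ω => (‖P k ω‖, (P k ω).arg) :=
    (hP.measurable k).norm.prodMk (Complex.measurable_arg.comp (hP.measurable k))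
  have h := congrArg (Measure.map Prod.fst) (hP.map_norm_arg ha hab k)
  rw [Measure.map_map measurable_fst hm, Measure.map_fst_prod, measure_univ, one_smul] at h
  exact h

lemma IsBPP.map_arg (hP : IsBPP μ P (annulus a b)) (ha : 0 < a) (hab : a < b) (k : Fin N) :
    μ.map (fun ω => (P k ω).arg) = angLaw := by
  have := isProbabilityMeasure_radLaw ha hab
  have hm : Measurable fun ω => (‖P k ω‖, (P k ω).arg) :=
    (hP.measurable k).norm.prodMk (Complex.measurable_arg.comp (hP.measurable k))
  have h := congrArg (Measure.map Prod.snd) (hP.map_norm_arg ha hab k)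
  rw [Measure.map_map measurable_snd hm, Measure.map_snd_prod, measure_univ, one_smul] at h
  exact h

lemma IsBPP.iIndepFun_norm {s : Set ℂ} (hP : IsBPP μ P s) : iIndepFun (fun k ω => ‖P k ω‖) μ :=
  hP.indep.comp (fun _ => norm) fun _ => measurable_norm

lemma IsBPP.iIndepFun_arg {s : Set ℂ} (hP : IsBPP μ P s) :
    iIndepFun (fun k ω => (P k ω).arg) μ :=
  hP.indep.comp (fun _ => Complex.arg) fun _ => Complex.measurable_arg

lemma IsBPP.measurable_norm {s : Set ℂ} (hP : IsBPP μ P s) :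
    Measurable fun ω k => ‖P k ω‖ := measurable_pi_lambda _ fun k => (hP.measurable k).norm

lemma IsBPP.measurable_arg {s : Set ℂ} (hP : IsBPP μ P s) :
    Measurable fun ω k => (P k ω).arg :=
  measurable_pi_lambda _ fun k => Complex.measurable_arg.comp (hP.measurable k)

/-- The pairs (radius, angle) have law `∏ₖ (radLaw × angLaw)`; regrouping the coordinates gives `(∏
radLaw) × (∏ angLaw)`. -/
lemma IsBPP.indepFun_norm_arg (hP : IsBPP μ P (annulus a b)) (ha : 0 < a) (hab : a < b) :
    IndepFun (fun ω k => ‖P k ω‖) (fun ω k => (P k ω).arg) μ := by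
  have := isProbabilityMeasure_radLaw ha hab
  have hmk : ∀ k, Measurable fun ω => (‖P k ω‖, (P k ω).arg) := fun k =>
    (hP.measurable k).norm.prodMk (Complex.measurable_arg.comp (hP.measurable k))
  have hm : Measurable fun z : ℂ => (‖z‖, z.arg) := _root_.measurable_norm.prodMk Complex.measurable_arg
  have hT : μ.map (fun ω k => (P k ω).arg) = Measure.pi fun k => μ.map fun ω => (P k ω).arg :=
    hP.iIndepFun_arg.map_fun_eq_pi_map fun k =>
      (Complex.measurable_arg.comp (hP.measurable k)).aemeasurable
  rw [indepFun_iff_map_prod_eq_prod_map_map hP.measurable_norm.aemeasurable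
    hP.measurable_arg.aemeasurable,
    hP.iIndepFun_norm.map_fun_eq_pi_map fun k => (hP.measurable k).norm.aemeasurable, hT]
  simp only [hP.map_norm ha hab, hP.map_arg ha hab]
  have hj : iIndepFun (fun k ω => (‖P k ω‖, (P k ω).arg)) μ := hP.indep.comp _ fun _ => hm
  have hj' := hj.map_fun_eq_pi_map fun k => (hmk k).aemeasurable
  simp only [hP.map_norm_arg ha hab] at hj'
  rw [← (measurePreserving_arrowProdEquivProdArrow ℝ ℝ (Fin N) (fun _ => radLaw a b)
    fun _ => angLaw).map_eq, ← hj',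
    Measure.map_map (MeasurableEquiv.measurable _) (measurable_pi_lambda _ hmk)]
  rfl

lemma IsBPP.ae_norm_mem_Icc (hP : IsBPP μ P (annulus a b)) (ha : 0 < a) (hab : a < b) :
    ∀ᵐ ω ∂μ, ∀ k, ‖P k ω‖ ∈ Icc a b := by
  rw [ae_all_iff]
  intro k
  have h := ae_radLaw_mem_Icc a b
  rw [← hP.map_norm ha hab k] at h
  exact ae_of_ae_map (hP.measurable k).norm.aemeasurable h

lemma IsBPP.ae_A_mem_Icc (hP : IsBPP μ P (annulus a b)) (ha : 0 < a) (hab : a < b) :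
    ∀ᵐ ω ∂μ, ∀ k, A (config P ω) k ∈ Icc (b ^ 2)⁻¹ (a ^ 2)⁻¹ := by
  filter_upwards [hP.ae_norm_mem_Icc ha hab] with ω h k
  have h0 := ha.trans_le (h k).1
  have h1 := (h k).1
  have h2 := (h k).2
  constructor <;> simp only [A, config] <;> gcongr

lemma IsBPP.measurable_A {s : Set ℂ} (hP : IsBPP μ P s) (k : Fin N) :
    Measurable fun ω => A (config P ω) k := ((hP.measurable k).norm.pow_const 2).inv

lemma IsBPP.iIndepFun_A {s : Set ℂ} (hP : IsBPP μ P s) :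
    iIndepFun (fun k ω => A (config P ω) k) μ :=
  hP.indep.comp (fun _ z => (‖z‖ ^ 2)⁻¹) fun _ => by fun_prop

lemma IsBPP.ae_A_ne (hP : IsBPP μ P (annulus a b)) (ha : 0 < a) (hab : a < b) (k : Fin N) (x : ℝ) :
    ∀ᵐ ω ∂μ, A (config P ω) k ≠ x := by
  have h : ∀ᵐ r ∂radLaw a b, (r ^ 2)⁻¹ ≠ x := by
    refine (radLaw_absolutelyContinuous a b).ae_le ?_
    have hf : ({√x⁻¹, -√x⁻¹} : Set ℝ).Finite := by simp
    filter_upwards [hf.countable.ae_notMem volume] with r hr hx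
    refine hr ?_
    rw [← hx, inv_inv, Real.sqrt_sq_eq_abs]
    rcases abs_choice r with h | h <;> simp [h]
  rw [← hP.map_norm ha hab k] at h
  exact ae_of_ae_map (hP.measurable k).norm.aemeasurable h

lemma IsBPP.measurable_sum_A {s : Set ℂ} (hP : IsBPP μ P s) (c : Fin N → ℝ) :
    Measurable fun ω => ∑ k, c k * A (config P ω) k :=
  Finset.measurable_sum _ fun k _ => (hP.measurable_A k).const_mul _

/-- A single term with nonzero coefficient is atomless and independent of the others, so the sum is
atomless. -/
lemma IsBPP.ae_sum_A_ne (hP : IsBPP μ P (annulus a b)) (ha : 0 < a) (hab : a < b) {c : Fin N → ℝ}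
    {k : Fin N} (hk : c k ≠ 0) (x : ℝ) : ∀ᵐ ω ∂μ, ∑ j, c j * A (config P ω) j ≠ x := by
  have hi : iIndepFun (fun k ω => c k * A (config P ω) k) μ :=
    hP.iIndepFun_A.comp (fun k x => c k * x) fun k => measurable_const_mul (c k)
  have hm : ∀ k, Measurable fun ω => c k * A (config P ω) k := fun k =>
    (hP.measurable_A k).const_mul _
  have h2 := (hi.indepFun_finsetSum_of_notMem hm (Finset.notMem_erase k Finset.univ)).symm
  have hs : Measurable (∑ j ∈ Finset.univ.erase k, fun ω => c j * A (config P ω) j) := by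
    have := Finset.measurable_sum (Finset.univ.erase k) fun j _ => hm j
    convert this using 1
    ext ω
    simp
  have h3 := ae_ne_of_indepFun (hm k) hs h2
    (fun y => by
      filter_upwards [hP.ae_A_ne ha hab k (y / c k)] with ω h h'
      exact h (by rw [← h']; field_simp)) (f := fun v => x - v) (by fun_prop)
  filter_upwards [h3] with ω h h'
  rw [← Finset.add_sum_erase _ _ (Finset.mem_univ k)] at h'
  refine h ?_
  simp only [Finset.sum_apply]
  linarith

lemma IsBPP.integral_cexp_A (hP : IsBPP μ P (annulus a b)) (ha : 0 < a) (hab : a < b) (k : Fin N)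
    (t : ℝ) : ∫ ω, Complex.exp (Complex.I * ((t * A (config P ω) k : ℝ) : ℂ)) ∂μ = phiA a b t := by
  rw [← integral_radLaw_cexp ha hab, ← hP.map_norm ha hab k, integral_map
    (hP.measurable k).norm.aemeasurable (Measurable.aestronglyMeasurable (by fun_prop))]
  rfl

lemma IsBPP.integral_cexp_sum_A (hP : IsBPP μ P (annulus a b)) (ha : 0 < a) (hab : a < b)
    (c : Fin N → ℝ) (t : ℝ) :
    ∫ ω, Complex.exp (Complex.I * ((t * ∑ k, c k * A (config P ω) k : ℝ) : ℂ)) ∂μ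
      = ∏ k, phiA a b (c k * t) := by
  have hi : iIndepFun (fun k ω => Complex.exp (Complex.I * ((c k * t * A (config P ω) k : ℝ) : ℂ)))
      μ := hP.iIndepFun_A.comp (fun k x => Complex.exp (Complex.I * ((c k * t * x : ℝ) : ℂ)))
        fun k => by fun_prop
  have h := hi.integral_fun_prod_eq_prod_integral fun k =>
    (Measurable.aestronglyMeasurable (by have := hP.measurable_A k; fun_prop))
  simp only [hP.integral_cexp_A ha hab] at h
  rw [← h]
  congr 1; ext ω
  rw [← Complex.exp_sum]
  congr 1
  push_cast
  rw [Finset.mul_sum, Finset.mul_sum]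
  exact Finset.sum_congr rfl fun k _ => by ring

lemma norm_phiA_le_one {a b : ℝ} (ha : 0 < a) (hab : a < b) (t : ℝ) : ‖phiA a b t‖ ≤ 1 := by
  have := isProbabilityMeasure_radLaw ha hab
  rw [← integral_radLaw_cexp ha hab]
  refine (norm_integral_le_of_norm_le_const (C := 1) (.of_forall fun r => ?_)).trans (by simp)
  rw [mul_comm, Complex.norm_exp_ofReal_mul_I]

/-- One factor supplies the decay `1/t`; the others are at most 1 in modulus. -/
lemma norm_prod_phiA_le (ha : 0 < a) (hab : a < b) {c : Fin N → ℝ} {k : Fin N} (hk : c k ≠ 0)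
    {t : ℝ} (ht : 0 < t) :
    ‖∏ j, phiA a b (c j * t)‖ ≤ 2 * b ^ 4 / (b ^ 2 - a ^ 2) / |c k| / t := by
  rw [← Finset.mul_prod_erase _ _ (Finset.mem_univ k), norm_mul, norm_prod]
  have h1 := norm_phiA_le ha hab (mul_ne_zero hk ht.ne')
  rw [abs_mul, abs_of_pos ht, ← div_div] at h1
  exact (mul_le_of_le_one_right (norm_nonneg _) (Finset.prod_le_one (fun _ _ => norm_nonneg _)
    fun _ _ => norm_phiA_le_one ha hab _)).trans h1

/-- Arbitrary coefficients cover two uses: all equal to 1 for `X`, and `δⱼₖ - u` for the event `B k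
> u`. -/
lemma IsBPP.gilPelaez_sum_A (hP : IsBPP μ P (annulus a b)) (ha : 0 < a) (hab : a < b)
    {c : Fin N → ℝ} {k : Fin N} (hk : c k ≠ 0) (x : ℝ) :
    IntegrableOn (gilPelaezIntegrand (fun t => ∏ j, phiA a b (c j * t)) x) (Ioi 0) ∧
    μ.real {ω | x < ∑ j, c j * A (config P ω) j} =
      gilPelaezCcdf (fun t => ∏ j, phiA a b (c j * t)) x := by
  have hZ : Measurable fun ω => ∑ j, c j * A (config P ω) j - x := (hP.measurable_sum_A c).sub_const x
  have hK : ∀ᵐ ω ∂μ, |∑ j, c j * A (config P ω) j - x| ≤ (∑ j, |c j| * (a ^ 2)⁻¹) + |x| := by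
    filter_upwards [hP.ae_A_mem_Icc ha hab] with ω h
    refine (abs_sub _ _).trans (add_le_add ((Finset.abs_sum_le_sum_abs _ _).trans ?_) le_rfl)
    refine Finset.sum_le_sum fun j _ => ?_
    rw [abs_mul, abs_of_nonneg (a := A _ _) (by simp only [A]; positivity)]
    exact mul_le_mul_of_nonneg_left (h j).2 (abs_nonneg _)
  have hφ : ∀ t : ℝ, Complex.exp (-(Complex.I * (t : ℂ) * (x : ℂ))) * ∏ j, phiA a b (c j * t)
      = ∫ ω, Complex.exp (Complex.I * ((t * (∑ j, c j * A (config P ω) j - x) : ℝ) : ℂ)) ∂μ := by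
    intro t
    rw [← hP.integral_cexp_sum_A ha hab, ← integral_const_mul]
    congr 1; ext ω
    rw [← Complex.exp_add]
    congr 1
    push_cast
    ring
  have hint := integrableOn_im_div hZ hK hφ (C := 2 * b ^ 4 / (b ^ 2 - a ^ 2) / |c k|)
    fun t ht => by
      have : -(Complex.I * (t : ℂ) * (x : ℂ)) = ((-(t * x) : ℝ) : ℂ) * Complex.I := by
        push_cast; ring
      rw [norm_mul, this, Complex.norm_exp_ofReal_mul_I, one_mul]
      exact norm_prod_phiA_le ha hab hk ht
  refine ⟨hint, ?_⟩
  have h := measureReal_pos_eq hZ hK hφ hint (by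
    filter_upwards [hP.ae_sum_A_ne ha hab hk x] with ω h
    exact sub_ne_zero.2 h)
  simp only [sub_pos] at h
  exact h

end Law

/-! ### The law of the modulus of an isotropic random vector -/

lemma inner_polarCoord_symm (ρ θ : ℝ) (ξ : ℂ) :
    inner ℝ (Complex.polarCoord.symm (ρ, θ)) ξ = ρ * ‖ξ‖ * Real.cos ((1 : ℕ) * θ - ξ.arg) := by
  rw [Complex.polarCoord_symm_apply, Complex.inner, Nat.cast_one, one_mul, Real.cos_sub,
    Complex.mul_re]
  have h1 := Complex.norm_mul_cos_arg ξ
  have h2 := Complex.norm_mul_sin_arg ξ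
  simp [Complex.cos_ofReal_re, Complex.sin_ofReal_re, Complex.cos_ofReal_im, Complex.sin_ofReal_im]
  linear_combination (-ρ * Real.cos θ) * h1 - (ρ * Real.sin θ) * h2

lemma abs_besselJ_one_le (x : ℝ) : |besselJ 1 x| ≤ |x| := by
  have h := intervalIntegral.norm_integral_le_of_norm_le_const (a := 0) (b := Real.pi) (C := |x|)
    (f := fun τ => Real.sin τ * Real.sin (x * Real.sin τ)) (fun t _ => by
      rw [norm_mul, Real.norm_eq_abs, Real.norm_eq_abs]
      refine (mul_le_of_le_one_left (abs_nonneg _) (Real.abs_sin_le_one t)).trans ?_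
      refine Real.abs_sin_le_abs.trans ?_
      rw [abs_mul]
      exact mul_le_of_le_one_right (abs_nonneg _) (Real.abs_sin_le_one t))
  rw [besselJ_one_eq, abs_mul, abs_of_pos (by positivity)]
  simp only [Real.norm_eq_abs, sub_zero, abs_of_pos Real.pi_pos] at h
  rw [one_div, inv_mul_le_iff₀ Real.pi_pos, mul_comm]
  exact h

/-- The Fourier transform of the indicator function of a disc. -/
lemma integral_ball_cexp_inner {r : ℝ} (hr : 0 < r) {ξ : ℂ} (hξ : ξ ≠ 0) :
    ∫ x in Metric.ball (0 : ℂ) r, Complex.exp (Complex.I * ((inner ℝ x ξ : ℝ) : ℂ))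
      = ((2 * Real.pi * (r * besselJ 1 (r * ‖ξ‖) / ‖ξ‖) : ℝ) : ℂ) := by
  have hn : ‖ξ‖ ≠ 0 := norm_ne_zero_iff.2 hξ
  let g : ℝ × ℝ → ℂ := fun p => p.1 •
    Complex.exp (Complex.I * ((p.1 * ‖ξ‖ * Real.cos ((1 : ℕ) * p.2 - ξ.arg) : ℝ) : ℂ))
  have hg : Continuous g := by fun_prop
  rw [← integral_indicator Metric.isOpen_ball.measurableSet, ← Complex.integral_comp_polarCoord_symm,
    polarCoord_target]
  have e : ∀ p ∈ Ioi (0 : ℝ) ×ˢ Ioo (-Real.pi) Real.pi, p.1 • (Metric.ball (0 : ℂ) r).indicator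
      (fun x => Complex.exp (Complex.I * ((inner ℝ x ξ : ℝ) : ℂ))) (Complex.polarCoord.symm p)
      = (Iio r ×ˢ univ).indicator g p := by
    rintro ⟨ρ, θ⟩ hp
    have hρ : 0 < ρ := hp.1
    have hmem : Complex.polarCoord.symm (ρ, θ) ∈ Metric.ball (0 : ℂ) r ↔
        (ρ, θ) ∈ Iio r ×ˢ (univ : Set ℝ) := by
      rw [mem_ball_zero_iff, Complex.norm_polarCoord_symm, abs_of_pos hρ]
      simp
    by_cases h : (ρ, θ) ∈ Iio r ×ˢ (univ : Set ℝ)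
    · rw [indicator_of_mem h, indicator_of_mem (hmem.2 h), inner_polarCoord_symm]
    · rw [indicator_of_notMem h, indicator_of_notMem (mt hmem.1 h), smul_zero]
  have hset : Ioi (0 : ℝ) ×ˢ Ioo (-Real.pi) Real.pi ∩ Iio r ×ˢ univ
      = Ioo 0 r ×ˢ Ioo (-Real.pi) Real.pi := by
    rw [prod_inter_prod, inter_univ, Ioi_inter_Iio]
  have hint : IntegrableOn g (Ioo 0 r ×ˢ Ioo (-Real.pi) Real.pi) (volume.prod volume) :=
    (hg.continuousOn.integrableOn_compact (isCompact_Icc.prod isCompact_Icc)).mono_set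
      (prod_mono Ioo_subset_Icc_self Ioo_subset_Icc_self)
  rw [setIntegral_congr_fun (measurableSet_Ioi.prod measurableSet_Ioo) e,
    setIntegral_indicator (measurableSet_Iio.prod .univ), hset, Measure.volume_eq_prod,
    setIntegral_prod g hint]
  have hθ : ∀ ρ : ℝ, ∫ θ in Ioo (-Real.pi) Real.pi, g (ρ, θ)
      = ((2 * Real.pi * (ρ * besselJ 0 (ρ * ‖ξ‖)) : ℝ) : ℂ) := by
    intro ρ
    rw [← integral_Ioc_eq_integral_Ioo,
      ← intervalIntegral.integral_of_le (by linarith [Real.pi_pos])]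
    simp only [g]
    rw [intervalIntegral.integral_smul, integral_cexp_mul_cos (ρ * ‖ξ‖) one_pos ξ.arg,
      Complex.real_smul]
    push_cast
    ring
  simp only [hθ]
  rw [integral_complex_ofReal, ← integral_Ioc_eq_integral_Ioo,
    ← intervalIntegral.integral_of_le hr.le, intervalIntegral.integral_const_mul]
  congr 2
  have hd : ∀ ρ ∈ uIcc 0 r, HasDerivAt (fun ρ => ρ * besselJ 1 (ρ * ‖ξ‖) / ‖ξ‖)
      (ρ * besselJ 0 (ρ * ‖ξ‖)) ρ := by
    intro ρ _
    have h := ((hasDerivAt_mul_besselJ_one (ρ * ‖ξ‖)).comp ρ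
      ((hasDerivAt_id ρ).mul_const ‖ξ‖)).div_const (‖ξ‖ ^ 2)
    refine (h.congr_of_eventuallyEq (.of_forall fun y => ?_)).congr_deriv ?_
    · simp only [Function.comp, id]
      field_simp
    · field_simp
  rw [intervalIntegral.integral_eq_sub_of_hasDerivAt hd (Continuous.intervalIntegrable
    (continuous_id.mul (continuous_besselJ_zero.comp (by fun_prop))) _ _)]
  simp

lemma integral_comp_norm_complex (f : ℝ → ℂ) :
    ∫ ξ : ℂ, f ‖ξ‖ = 2 * Real.pi * ∫ y in Ioi (0 : ℝ), y * f y := by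
  rw [integral_fun_norm_addHaar (volume : Measure ℂ) f, Complex.finrank_real_complex, Measure.real,
    Complex.volume_ball]
  simp [mul_assoc]

/-! ### Smoothing the indicator of a disc by the heat kernel. -/

/-- The heat kernel of the plane. -/
noncomputable def heatKernel (c : ℝ) (w : ℂ) : ℂ :=
  Real.pi * c * Complex.exp (-Real.pi ^ 2 * c * ‖w‖ ^ 2)

lemma continuous_heatKernel (c : ℝ) : Continuous (heatKernel c) := by
  unfold heatKernel
  fun_prop

/-- Gaussian Fourier inversion at heat time `1/(4π²c)`. Thus `c → ∞` is the small-time limit, in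
which the damping factor tends to 1. -/
lemma heatKernel_eq_integral {c : ℝ} (hc : 0 < c) (w : ℂ) :
    heatKernel c w = 1 / (4 * Real.pi ^ 2) * ∫ ξ : ℂ,
      Complex.exp (-((1 / (4 * Real.pi ^ 2 * c) : ℝ) : ℂ) * ‖ξ‖ ^ 2
        + Complex.I * ((inner ℝ w ξ : ℝ) : ℂ)) := by
  have hb : 0 < (((1 / (4 * Real.pi ^ 2 * c) : ℝ) : ℂ)).re := by
    rw [Complex.ofReal_re]
    positivity
  have hp : (Real.pi : ℂ) ≠ 0 := by exact_mod_cast Real.pi_ne_zero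
  have hc' : (c : ℂ) ≠ 0 := by exact_mod_cast hc.ne'
  rw [GaussianFourier.integral_cexp_neg_mul_sq_norm_add hb, Complex.finrank_real_complex,
    heatKernel, Complex.I_sq]
  push_cast
  rw [div_self (two_ne_zero), Complex.cpow_one, ← mul_assoc]
  congr 1
  · field_simp
  · congr 1
    field_simp

lemma norm_heatKernel {c : ℝ} (hc : 0 < c) (w : ℂ) :
    ‖heatKernel c w‖ = Real.pi * c * Real.exp (-(Real.pi ^ 2 * c) * ‖w‖ ^ 2) := by
  rw [heatKernel, norm_mul, Complex.norm_exp, norm_mul, Complex.norm_real, Complex.norm_real,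
    Real.norm_eq_abs, Real.norm_eq_abs, abs_of_pos Real.pi_pos, abs_of_pos hc]
  congr 2
  have : -(Real.pi : ℂ) ^ 2 * c * ‖w‖ ^ 2 = ((-(Real.pi ^ 2 * c) * ‖w‖ ^ 2 : ℝ) : ℂ) := by
    push_cast; ring
  rw [this, Complex.ofReal_re]

lemma integral_norm_heatKernel {c : ℝ} (hc : 0 < c) : ∫ w, ‖heatKernel c w‖ = 1 := by
  simp only [norm_heatKernel hc]
  rw [integral_const_mul, GaussianFourier.integral_rexp_neg_mul_sq_norm (by positivity),
    Complex.finrank_real_complex, Nat.cast_ofNat, div_self two_ne_zero, Real.rpow_one]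
  field_simp

lemma integrable_heatKernel {c : ℝ} (hc : 0 < c) : Integrable (heatKernel c) := by
  rw [← integrable_norm_iff (continuous_heatKernel c).aestronglyMeasurable]
  exact Integrable.of_integral_ne_zero (by rw [integral_norm_heatKernel hc]; exact one_ne_zero)

/-- The indicator function of a disc, smoothed by the heat kernel. -/
noncomputable def smoothedBall (c r : ℝ) (s : ℂ) : ℂ :=
  ∫ w in Metric.ball (0 : ℂ) r, heatKernel c (s - w)

lemma norm_smoothedBall_le {c : ℝ} (hc : 0 < c) (r : ℝ) (s : ℂ) : ‖smoothedBall c r s‖ ≤ 1 := by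
  have hi : Integrable fun w => ‖heatKernel c (s - w)‖ :=
    ((integrable_heatKernel hc).comp_sub_left s).norm
  calc ‖smoothedBall c r s‖ ≤ ∫ w in Metric.ball (0 : ℂ) r, ‖heatKernel c (s - w)‖ :=
        norm_integral_le_integral_norm _
    _ ≤ ∫ w, ‖heatKernel c (s - w)‖ :=
        setIntegral_le_integral hi (.of_forall fun _ => norm_nonneg _)
    _ = 1 := by
        rw [integral_sub_left_eq_self (fun w => ‖heatKernel c w‖), integral_norm_heatKernel hc]

lemma stronglyMeasurable_smoothedBall (c r : ℝ) : StronglyMeasurable (smoothedBall c r) := by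
  have h : Continuous fun p : ℂ × ℂ => heatKernel c (p.1 - p.2) :=
    (continuous_heatKernel c).comp (by fun_prop)
  exact h.stronglyMeasurable.integral_prod_right' (ν := volume.restrict (Metric.ball (0 : ℂ) r))

/-- The Gaussians form an approximate identity, so they recover the indicator at its points of
continuity, that is, off the circle. -/
lemma tendsto_smoothedBall {r : ℝ} {s : ℂ} (hs : ‖s‖ ≠ r) :
    Tendsto (fun c => smoothedBall c r s) atTop (𝓝 ({s | ‖s‖ < r}.indicator 1 s)) := by
  have hf : Integrable ((Metric.ball (0 : ℂ) r).indicator (1 : ℂ → ℂ)) := by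
    rw [integrable_indicator_iff Metric.isOpen_ball.measurableSet]
    exact integrableOn_const (by simp [Complex.volume_ball, ENNReal.mul_eq_top])
  have hc : ContinuousAt ((Metric.ball (0 : ℂ) r).indicator (1 : ℂ → ℂ)) s := by
    rcases lt_or_gt_of_ne hs with h | h
    · have : (Metric.ball (0 : ℂ) r).indicator (1 : ℂ → ℂ) =ᶠ[𝓝 s] fun _ => 1 := by
        filter_upwards [Metric.isOpen_ball.mem_nhds (mem_ball_zero_iff.2 h)] with x hx
        rw [indicator_of_mem hx, Pi.one_apply]
      exact continuousAt_const.congr this.symm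
    · have : (Metric.ball (0 : ℂ) r).indicator (1 : ℂ → ℂ) =ᶠ[𝓝 s] fun _ => 0 := by
        filter_upwards [(isOpen_lt continuous_const continuous_norm).mem_nhds h] with x hx
        rw [indicator_of_notMem (by simpa using le_of_lt hx)]
      exact continuousAt_const.congr this.symm
  have h := Real.tendsto_integral_gaussian_smul' hf hc
  have e : (Metric.ball (0 : ℂ) r).indicator (1 : ℂ → ℂ) s = {s | ‖s‖ < r}.indicator 1 s := by
    congr 1; ext x; simp
  rw [e] at h
  refine h.congr fun c => ?_
  rw [smoothedBall, ← integral_indicator Metric.isOpen_ball.measurableSet]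
  congr 1; ext w
  rw [Complex.finrank_real_complex]
  by_cases hw : w ∈ Metric.ball (0 : ℂ) r
  · rw [indicator_of_mem hw, indicator_of_mem hw, heatKernel]
    simp
  · rw [indicator_of_notMem hw, indicator_of_notMem hw, smul_zero]

lemma integrable_exp_neg_mul_sq_norm {β : ℝ} (hβ : 0 < β) :
    Integrable fun ξ : ℂ => Real.exp (-β * ‖ξ‖ ^ 2) :=
  Integrable.of_integral_ne_zero (by
    rw [GaussianFourier.integral_rexp_neg_mul_sq_norm hβ]; positivity)

lemma smoothedBall_eq_integral {c r : ℝ} (hc : 0 < c) (hr : 0 < r) (s : ℂ) :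
    smoothedBall c r s = 1 / (4 * Real.pi ^ 2) * ∫ ξ : ℂ,
      ((Real.exp (-(1 / (4 * Real.pi ^ 2 * c)) * ‖ξ‖ ^ 2) *
        (2 * Real.pi * (r * besselJ 1 (r * ‖ξ‖) / ‖ξ‖)) : ℝ) : ℂ) *
          Complex.exp (Complex.I * ((inner ℝ s ξ : ℝ) : ℂ)) := by
  set β := 1 / (4 * Real.pi ^ 2 * c) with hβ
  have hβ0 : 0 < β := by positivity
  have hfin : IsFiniteMeasure (volume.restrict (Metric.ball (0 : ℂ) r)) :=
    ⟨by simp [Complex.volume_ball, ENNReal.mul_lt_top]⟩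
  rw [smoothedBall]
  simp only [heatKernel_eq_integral hc, ← hβ]
  rw [integral_const_mul, integral_integral_swap]
  · congr 1
    refine integral_congr_ae ?_
    have h0 : ∀ᵐ ξ : ℂ, ξ ≠ 0 := by simp [ae_iff]
    filter_upwards [h0] with ξ hξ
    -- `s - w` puts `-ξ` in the transform of the disc, which depends on the norm only.
    have hb := integral_ball_cexp_inner hr (neg_ne_zero.2 hξ)
    rw [norm_neg] at hb
    rw [Complex.ofReal_mul, ← hb, ← integral_const_mul, ← integral_mul_const]
    congr 1; ext w
    rw [Complex.ofReal_exp, ← Complex.exp_add, ← Complex.exp_add, inner_sub_left, inner_neg_right]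
    congr 1
    push_cast
    ring
  · have hb : Integrable (fun p : ℂ × ℂ => Real.exp (-β * ‖p.2‖ ^ 2))
        ((volume.restrict (Metric.ball (0 : ℂ) r)).prod volume) :=
      (integrable_exp_neg_mul_sq_norm hβ0).comp_snd _
    refine hb.mono' (Continuous.aestronglyMeasurable (by unfold Function.uncurry; fun_prop))
      (.of_forall fun p => le_of_eq ?_)
    rw [Function.uncurry_def, Complex.norm_exp]
    congr 1
    simp [← Complex.ofReal_pow]

/-! ### Kluyver's formula for the modulus of an isotropic vector. -/

section Isotropic

variable {Ω' : Type*} [MeasurableSpace Ω'] {m : Measure Ω'} [IsProbabilityMeasure m] {S : Ω' → ℂ}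
  {ψ : ℝ → ℝ}

/-- Fubini turns the exponential into `ψ ‖ξ‖`; the Jacobian `y` of polar coordinates in `ξ` then
cancels the `1/‖ξ‖` of the transform of the disc. -/
lemma integral_smoothedBall (hS : Measurable S)
    (hψ : ∀ ξ : ℂ, ∫ ω, Complex.exp (Complex.I * ((inner ℝ (S ω) ξ : ℝ) : ℂ)) ∂m = ψ ‖ξ‖)
    {c r : ℝ} (hc : 0 < c) (hr : 0 < r) :
    ∫ ω, smoothedBall c r (S ω) ∂m = ((∫ y in Ioi (0 : ℝ),
      r * (besselJ 1 (r * y) * ψ y) * Real.exp (-(1 / (4 * Real.pi ^ 2 * c)) * y ^ 2) : ℝ) : ℂ) := by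
  simp only [smoothedBall_eq_integral hc hr]
  set β := 1 / (4 * Real.pi ^ 2 * c) with hβ
  have hβ0 : 0 < β := by positivity
  have hJ : Measurable (besselJ 1) := continuous_besselJ_one.measurable
  rw [integral_const_mul, integral_integral_swap]
  · simp only [integral_const_mul, hψ]
    have := integral_comp_norm_complex fun y => ((Real.exp (-β * y ^ 2) *
        (2 * Real.pi * (r * besselJ 1 (r * y) / y)) : ℝ) : ℂ) * (ψ y : ℂ)
    rw [this, ← mul_assoc, ← integral_const_mul, ← integral_complex_ofReal]
    refine setIntegral_congr_fun measurableSet_Ioi fun y hy => ?_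
    have hy' : (y : ℂ) ≠ 0 := by exact_mod_cast (ne_of_gt hy)
    have hp : (Real.pi : ℂ) ≠ 0 := by exact_mod_cast Real.pi_ne_zero
    push_cast
    field_simp
    ring
  · have hb : Integrable (fun p : Ω' × ℂ => Real.exp (-β * ‖p.2‖ ^ 2) * (2 * Real.pi * (r * r)))
        (m.prod volume) :=
      ((integrable_exp_neg_mul_sq_norm hβ0).mul_const _).comp_snd _
    refine hb.mono' (Measurable.aestronglyMeasurable (by unfold Function.uncurry; fun_prop))
      (.of_forall fun p => ?_)
    rw [Function.uncurry_def, norm_mul, mul_comm Complex.I, Complex.norm_exp_ofReal_mul_I, mul_one,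
      Complex.norm_real, norm_mul, Real.norm_eq_abs, Real.norm_eq_abs, Real.abs_exp, abs_mul,
      abs_of_pos (by positivity : 0 < 2 * Real.pi), abs_div, abs_mul, abs_of_pos hr, abs_norm]
    refine mul_le_mul_of_nonneg_left (mul_le_mul_of_nonneg_left ?_ (by positivity))
      (Real.exp_nonneg _)
    -- `|J₁ x| ≤ |x|` removes the singularity at `ξ = 0`.
    refine div_le_of_le_mul₀ (norm_nonneg _) (by positivity) ?_
    rw [mul_assoc]
    refine mul_le_mul_of_nonneg_left ((abs_besselJ_one_le _).trans_eq ?_) hr.le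
    rw [abs_of_nonneg (by positivity)]

lemma measureReal_norm_lt_of_ne (hS : Measurable S)
    (hψ : ∀ ξ : ℂ, ∫ ω, Complex.exp (Complex.I * ((inner ℝ (S ω) ξ : ℝ) : ℂ)) ∂m = ψ ‖ξ‖)
    (hψi : IntegrableOn ψ (Ioi 0)) {r : ℝ} (hr : 0 < r) (h0 : ∀ᵐ ω ∂m, ‖S ω‖ ≠ r) :
    m.real {ω | ‖S ω‖ < r} = r * ∫ y in Ioi (0 : ℝ), besselJ 1 (r * y) * ψ y := by
  have hJ : Measurable (besselJ 1) := continuous_besselJ_one.measurable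
  have hm : MeasurableSet {ω | ‖S ω‖ < r} := measurableSet_lt hS.norm measurable_const
  have hJψ : IntegrableOn (fun y => r * (besselJ 1 (r * y) * ψ y)) (Ioi 0) := by
    refine (hψi.bdd_mul (c := 1) (Measurable.aestronglyMeasurable (by fun_prop))
      (.of_forall fun y => abs_besselJ_le_one 1 _)).const_mul r
  have hL : Tendsto (fun c => ∫ ω, smoothedBall c r (S ω) ∂m) atTop
      (𝓝 (∫ ω, {ω | ‖S ω‖ < r}.indicator 1 ω ∂m)) := by
    refine tendsto_integral_filter_of_dominated_convergence (fun _ => 1) ?_ ?_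
      (integrable_const _) ?_
    · exact .of_forall fun c =>
        ((stronglyMeasurable_smoothedBall c r).comp_measurable hS).aestronglyMeasurable
    · filter_upwards [eventually_gt_atTop 0] with c hc
      exact .of_forall fun ω => norm_smoothedBall_le hc r _
    · filter_upwards [h0] with ω hω
      exact tendsto_smoothedBall hω
  have hR : Tendsto (fun c : ℝ => ∫ y in Ioi (0 : ℝ),
      r * (besselJ 1 (r * y) * ψ y) * Real.exp (-(1 / (4 * Real.pi ^ 2 * c)) * y ^ 2)) atTop
      (𝓝 (∫ y in Ioi (0 : ℝ), r * (besselJ 1 (r * y) * ψ y))) := by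
    refine tendsto_integral_filter_of_dominated_convergence
      (fun y => ‖r * (besselJ 1 (r * y) * ψ y)‖) ?_ ?_ hJψ.norm ?_
    · exact .of_forall fun c => hJψ.1.mul (Continuous.aestronglyMeasurable (by fun_prop))
    · filter_upwards [eventually_gt_atTop 0] with c hc
      refine .of_forall fun y => ?_
      rw [norm_mul]
      refine mul_le_of_le_one_right (norm_nonneg _) ?_
      rw [Real.norm_eq_abs, Real.abs_exp, Real.exp_le_one_iff, neg_mul, neg_nonpos]
      positivity
    · refine .of_forall fun y => ?_
      have h1 : Tendsto (fun c : ℝ => 1 / (4 * Real.pi ^ 2 * c)) atTop (𝓝 0) :=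
        (tendsto_id.const_mul_atTop (by positivity)).const_div_atTop 1
      have h2 := ((Real.continuous_exp.tendsto _).comp (h1.neg.mul_const (y ^ 2))).const_mul
        (r * (besselJ 1 (r * y) * ψ y))
      simpa using h2
  have hR' := (Complex.continuous_ofReal.tendsto _).comp hR
  have h := tendsto_nhds_unique (hL.congr' ((eventually_gt_atTop 0).mono fun c hc =>
    integral_smoothedBall hS hψ hc hr)) hR'
  rw [integral_indicator hm, integral_const_mul] at h
  simp only [Pi.one_apply, integral_const, measureReal_restrict_apply_univ] at h
  rw [Complex.real_smul, mul_one] at h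
  exact_mod_cast h

/-- The modulus has countably many atoms, so `r` is a limit of smaller non-atoms `u n`. From below
the events increase to `‖S‖ < r`, and the right side is continuous in the radius. -/
lemma measureReal_norm_lt (hS : Measurable S)
    (hψ : ∀ ξ : ℂ, ∫ ω, Complex.exp (Complex.I * ((inner ℝ (S ω) ξ : ℝ) : ℂ)) ∂m = ψ ‖ξ‖)
    (hψi : IntegrableOn ψ (Ioi 0)) {r : ℝ} (hr : 0 < r) :
    m.real {ω | ‖S ω‖ < r} = r * ∫ y in Ioi (0 : ℝ), besselJ 1 (r * y) * ψ y := by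
  have hJ : Measurable (besselJ 1) := continuous_besselJ_one.measurable
  have hcount : {x : ℝ | 0 < m {ω | ‖S ω‖ = x}}.Countable := by
    refine Measure.countable_meas_pos_of_disjoint_iUnion (μ := m) (As := fun x => {ω | ‖S ω‖ = x})
      (fun x => measurableSet_eq_fun hS.norm measurable_const) fun x y hxy => ?_
    exact disjoint_left.2 fun ω (h1 : _ = _) (h2 : _ = _) => hxy (h1.symm.trans h2)
  obtain ⟨u, hu, hmem, hlim⟩ := (hcount.dense_compl ℝ).exists_seq_strictMono_tendsto_of_lt hr
  have hne : ∀ n, ∀ᵐ ω ∂m, ‖S ω‖ ≠ u n := fun n => by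
    have h := (hmem n).2
    simpa [ae_iff] using h
  have hlt : ∀ n, u n < r := fun n => (hmem n).1.2
  have h1 : Tendsto (fun n => m.real {ω | ‖S ω‖ < u n}) atTop (𝓝 (m.real {ω | ‖S ω‖ < r})) := by
    have hU : ⋃ n, {ω | ‖S ω‖ < u n} = {ω | ‖S ω‖ < r} := by
      ext ω
      simp only [mem_iUnion]
      refine ⟨fun ⟨n, h⟩ => lt_trans h (hlt n), fun h => ?_⟩
      exact ((tendsto_order.1 hlim).1 _ h).exists
    have := tendsto_measure_iUnion_atTop (μ := m) (s := fun n => {ω | ‖S ω‖ < u n})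
      fun i j hij ω (h : _ < _) => lt_of_lt_of_le h (hu.monotone hij)
    rw [hU] at this
    exact (ENNReal.tendsto_toReal (measure_ne_top _ _)).comp this
  have h2 : Tendsto (fun n => u n * ∫ y in Ioi (0 : ℝ), besselJ 1 (u n * y) * ψ y) atTop
      (𝓝 (r * ∫ y in Ioi (0 : ℝ), besselJ 1 (r * y) * ψ y)) := by
    refine hlim.mul (tendsto_integral_of_dominated_convergence (fun y => ‖ψ y‖) (fun n => ?_)
      hψi.norm (fun n => .of_forall fun y => ?_) (.of_forall fun y => ?_))
    · exact (Measurable.aestronglyMeasurable (by fun_prop)).mul hψi.1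
    · rw [norm_mul]
      exact mul_le_of_le_one_left (norm_nonneg _) (abs_besselJ_le_one 1 _)
    · exact ((continuous_besselJ_one.tendsto _).comp (hlim.mul_const y)).mul_const _
  refine tendsto_nhds_unique h1 (h2.congr fun n => ?_)
  exact (measureReal_norm_lt_of_ne hS hψ hψi (hmem n).1.1 (hne n)).symm

end Isotropic

/-! ### Deterministic identities -/

lemma cos_two_mul_angle (z : ℂ) : Real.cos (2 * angle z) = Real.cos (2 * z.arg) := by
  unfold angle
  split_ifs
  · rw [mul_add, Real.cos_eq_cos_iff]
    exact ⟨-2, Or.inl (by push_cast; ring)⟩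
  · rfl

lemma sin_two_mul_angle (z : ℂ) : Real.sin (2 * angle z) = Real.sin (2 * z.arg) := by
  unfold angle
  split_ifs
  · rw [mul_add, Real.sin_eq_sin_iff]
    exact ⟨-2, Or.inl (by push_cast; ring)⟩
  · rfl

section Deterministic

variable {N : ℕ}

lemma sq_sum_cos_add_sq_sum_sin (w x : Fin N → ℝ) :
    (∑ k, w k * Real.cos (x k)) ^ 2 + (∑ k, w k * Real.sin (x k)) ^ 2
      = ∑ j, ∑ k, w j * w k * Real.cos (x j - x k) := by
  rw [sq, sq, Finset.sum_mul_sum, Finset.sum_mul_sum, ← Finset.sum_add_distrib]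
  refine Finset.sum_congr rfl fun j _ => ?_
  rw [← Finset.sum_add_distrib]
  refine Finset.sum_congr rfl fun k _ => ?_
  rw [Real.cos_sub]
  ring

/-- As the weights sum to 1, the expression is `∑ⱼₖ wⱼ wₖ (1 - cos (xⱼ - xₖ))`, a sum of nonnegative
terms. It serves `Y` with weights `B` and `W` with weights `1/N`. -/
lemma one_sub_sq_sum_pos {w x : Fin N → ℝ} (hw : ∀ k, 0 < w k) (h1 : ∑ k, w k = 1) {i j : Fin N}
    (hij : Real.cos (x i - x j) ≠ 1) :
    0 < 1 - (∑ k, w k * Real.cos (x k)) ^ 2 - (∑ k, w k * Real.sin (x k)) ^ 2 := by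
  have h : 1 - (∑ k, w k * Real.cos (x k)) ^ 2 - (∑ k, w k * Real.sin (x k)) ^ 2
      = ∑ j, ∑ k, w j * w k * (1 - Real.cos (x j - x k)) := by
    simp only [mul_sub, mul_one, Finset.sum_sub_distrib]
    rw [sub_sub, sq_sum_cos_add_sq_sum_sin, ← Finset.sum_mul_sum, h1, one_mul]
  have hn : ∀ j k, 0 ≤ w j * w k * (1 - Real.cos (x j - x k)) := fun j k =>
    mul_nonneg (mul_pos (hw j) (hw k)).le (sub_nonneg.2 (Real.cos_le_one _))
  rw [h]
  refine Finset.sum_pos' (fun j _ => Finset.sum_nonneg fun k _ => hn j k)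
    ⟨i, Finset.mem_univ _, Finset.sum_pos' (fun k _ => hn i k) ⟨j, Finset.mem_univ _, ?_⟩⟩
  exact mul_pos (mul_pos (hw i) (hw j)) (sub_pos.2 (lt_of_le_of_ne (Real.cos_le_one _) hij))

lemma Y_eq (p : Fin N → ℂ) : Y p = 1 - (∑ k, B p k * Real.cos (2 * (p k).arg)) ^ 2
    - (∑ k, B p k * Real.sin (2 * (p k).arg)) ^ 2 := by
  simp only [Y, cos_two_mul_angle, sin_two_mul_angle]

lemma W_eq (p : Fin N → ℂ) : W p = 1 - 1 / (N : ℝ) ^ 2 *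
    ((∑ k, Real.cos (2 * (p k).arg)) ^ 2 + (∑ k, Real.sin (2 * (p k).arg)) ^ 2) := by
  simp only [W, cos_two_mul_angle, sin_two_mul_angle]

lemma W_eq_weighted (p : Fin N → ℂ) :
    W p = 1 - (∑ k, 1 / (N : ℝ) * Real.cos (2 * (p k).arg)) ^ 2
      - (∑ k, 1 / (N : ℝ) * Real.sin (2 * (p k).arg)) ^ 2 := by
  rw [W_eq, ← Finset.mul_sum, ← Finset.mul_sum]
  ring

lemma W_le_one (p : Fin N → ℂ) : W p ≤ 1 := by
  rw [W_eq]
  exact sub_le_self _ (by positivity)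

lemma X_pos [NeZero N] {p : Fin N → ℂ} (hp : ∀ k, 0 < A p k) : 0 < X p :=
  Finset.sum_pos (fun k _ => hp k) Finset.univ_nonempty

lemma sum_B_eq_one {p : Fin N → ℂ} (hX : X p ≠ 0) : ∑ k, B p k = 1 := by
  simp only [B, ← Finset.sum_div]
  exact div_self hX

lemma B_pos [NeZero N] {p : Fin N → ℂ} (hp : ∀ k, 0 < A p k) (k : Fin N) : 0 < B p k :=
  div_pos (hp k) (X_pos hp)

/-- With `e = ∑ₖ λₖ cos 2Θₖ` and `f = ∑ₖ λₖ sin 2Θₖ`, the information matrix is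
`(λ + e, f; f, λ - e) / 2`, where `λ` is the sum of the intensities. -/
lemma infoMatrix_eq (Ts : ℝ) (p : Fin N → ℂ) : infoMatrix Ts p = !![
    Ts / 2 * (X p + ∑ k, A p k * Real.cos (2 * angle (p k))),
    Ts / 2 * ∑ k, A p k * Real.sin (2 * angle (p k));
    Ts / 2 * ∑ k, A p k * Real.sin (2 * angle (p k)),
    Ts / 2 * (X p - ∑ k, A p k * Real.cos (2 * angle (p k)))] := by
  ext i j
  simp only [infoMatrix, Matrix.sum_apply, Matrix.smul_apply, Matrix.vecMulVec_apply, unitVec, X, A,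
    smul_eq_mul]
  fin_cases i <;> fin_cases j <;>
    simp only [Fin.zero_eta, Fin.mk_one, Matrix.of_apply, Matrix.cons_val_zero, Matrix.cons_val_one,
      Matrix.cons_val', Matrix.cons_val_fin_one, ← Finset.sum_add_distrib,
      ← Finset.sum_sub_distrib, Finset.mul_sum, Real.cos_two_mul', Real.sin_two_mul] <;>
    refine Finset.sum_congr rfl fun k _ => ?_
  · linear_combination (Ts / 2 * (‖p k‖ ^ 2)⁻¹) * Real.sin_sq_add_cos_sq (angle (p k))
  · ring
  · ring
  · linear_combination (Ts / 2 * (‖p k‖ ^ 2)⁻¹) * Real.sin_sq_add_cos_sq (angle (p k))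

lemma trace_inv_of_sym {u v w : ℝ} : ((!![u, v; v, w] : Matrix (Fin 2) (Fin 2) ℝ)⁻¹).trace
    = (u + w) / (u * w - v * v) := by
  rw [Matrix.inv_def, Matrix.adjugate_fin_two_of, Matrix.det_fin_two_of, Ring.inverse_eq_inv']
  simp [Matrix.trace_fin_two]
  ring

lemma det_infoMatrix (Ts : ℝ) {p : Fin N → ℂ} (hX : X p ≠ 0) :
    (infoMatrix Ts p).det = Ts ^ 2 / 4 * X p ^ 2 * Y p := by
  rw [infoMatrix_eq, Matrix.det_fin_two_of, Y]
  simp only [B, div_mul_eq_mul_div, ← Finset.sum_div]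
  field_simp
  ring

lemma speb_eq {Ts : ℝ} (hTs : 0 < Ts) {p : Fin N → ℂ} (hX : 0 < X p) (hY : 0 < Y p) :
    speb Ts p = 4 / (Ts * X p * Y p) := by
  have hd := det_infoMatrix Ts hX.ne'
  rw [infoMatrix_eq, Matrix.det_fin_two_of] at hd
  rw [speb, infoMatrix_eq, trace_inv_of_sym, hd]
  field_simp
  ring

lemma rhoMin_pos {N : ℕ} (hN : 3 ≤ N) {a b : ℝ} (ha : 0 < a) (hb : 0 < b) : 0 < rhoMin N a b := by
  have : (1 : ℝ) < N := by exact_mod_cast (by omega : 1 < N)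
  have := sub_pos.2 this
  unfold rhoMin
  positivity

lemma rhoMax_lt_one {N : ℕ} (hN : 3 ≤ N) {a b : ℝ} (ha : 0 < a) (hb : 0 < b) :
    rhoMax N a b < 1 := by
  have : (1 : ℝ) < N := by exact_mod_cast (by omega : 1 < N)
  have := sub_pos.2 this
  rw [rhoMax, div_lt_one (by positivity)]
  exact lt_add_of_pos_right _ (by positivity)

lemma div_add_le_div_add {s t s' t' : ℝ} (hs : 0 < s) (ht : 0 < t) (ht' : 0 < t') (hss : s ≤ s')
    (htt : t' ≤ t) : s / (s + t) ≤ s' / (s' + t') := by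
  have hs' := hs.trans_le hss
  rw [div_le_div_iff₀ (by positivity) (by positivity)]
  nlinarith [mul_le_mul hss htt ht'.le hs'.le]

lemma rhoMin_le_rhoMax {N : ℕ} (hN : 3 ≤ N) {a b : ℝ} (ha : 0 < a) (hab : a < b) :
    rhoMin N a b ≤ rhoMax N a b := by
  have : (1 : ℝ) < N := by exact_mod_cast (by omega : 1 < N)
  have := sub_pos.2 this
  have hb := ha.trans hab
  have h : (b ^ 2)⁻¹ ≤ (a ^ 2)⁻¹ := by gcongr
  exact div_add_le_div_add (by positivity) (by positivity) (by positivity) h (by gcongr)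

lemma B_mem_Icc {N : ℕ} (hN : 3 ≤ N) {a b : ℝ} (ha : 0 < a) (hab : a < b) {p : Fin N → ℂ}
    (hp : ∀ k, A p k ∈ Icc (b ^ 2)⁻¹ (a ^ 2)⁻¹) (k : Fin N) :
    B p k ∈ Icc (rhoMin N a b) (rhoMax N a b) := by
  have : (1 : ℝ) < N := by exact_mod_cast (by omega : 1 < N)
  have := sub_pos.2 this
  have hb := ha.trans hab
  have hb2 : 0 < (b ^ 2)⁻¹ := by positivity
  have hcard : ((Finset.univ.erase k).card : ℝ) = (N : ℝ) - 1 := by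
    rw [Finset.card_erase_of_mem (Finset.mem_univ k), Finset.card_univ, Fintype.card_fin,
      Nat.cast_sub (by omega), Nat.cast_one]
  have h1 := Finset.card_nsmul_le_sum (Finset.univ.erase k) (A p) _ fun j _ => (hp j).1
  have h2 := Finset.sum_le_card_nsmul (Finset.univ.erase k) (A p) _ fun j _ => (hp j).2
  rw [nsmul_eq_mul, hcard] at h1 h2
  have hpos : 0 < ((N : ℝ) - 1) * (b ^ 2)⁻¹ := by positivity
  rw [B, X, ← Finset.add_sum_erase _ _ (Finset.mem_univ k)]
  exact ⟨div_add_le_div_add hb2 (by positivity) (hpos.trans_le h1) (hp k).1 h2,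
    div_add_le_div_add (hb2.trans_le (hp k).1) (hpos.trans_le h1) hpos (hp k).2 h1⟩

end Deterministic

/-! ### A layer-cake formula -/

/-- Fubini applied to `Z² = p² + ∫ 2u 1{u < Z}` over `u` in `(p, q]`. -/
lemma integral_sq_eq_add_integral {Ω : Type*} [MeasurableSpace Ω] {m : Measure Ω}
    [IsProbabilityMeasure m] {Z : Ω → ℝ} (hZ : Measurable Z) {p q : ℝ} (hpq : p ≤ q)
    (h : ∀ᵐ ω ∂m, Z ω ∈ Icc p q) :
    ∫ ω, Z ω ^ 2 ∂m = p ^ 2 + ∫ u in p..q, 2 * u * m.real {ω | u < Z ω} := by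
  have hm : ∀ u, MeasurableSet {ω | u < Z ω} := fun u => measurableSet_lt measurable_const hZ
  have hms : MeasurableSet {r : ℝ × Ω | r.1 < Z r.2} :=
    measurableSet_lt measurable_fst (hZ.comp measurable_snd)
  have e1 : ∀ u : ℝ, 2 * u * m.real {ω | u < Z ω}
      = ∫ ω, {r : ℝ × Ω | r.1 < Z r.2}.indicator (fun r => 2 * r.1) (u, ω) ∂m := by
    intro u
    rw [← integral_indicator_one (hm u), ← integral_const_mul]
    congr 1; ext ω
    by_cases h : u < Z ω
    · rw [indicator_of_mem (by exact h), indicator_of_mem (by exact h), Pi.one_apply, mul_one]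
    · rw [indicator_of_notMem (by exact h), indicator_of_notMem (by exact h), mul_zero]
  have hint : Integrable ({r : ℝ × Ω | r.1 < Z r.2}.indicator fun r => 2 * r.1)
      ((volume.restrict (Ioc p q)).prod m) := by
    refine Integrable.indicator ?_ hms
    have : IntegrableOn (fun u : ℝ => 2 * u) (Ioc p q) :=
      (Continuous.integrableOn_Icc (by fun_prop)).mono_set Ioc_subset_Icc_self
    exact Integrable.comp_fst this m
  simp only [e1]
  rw [intervalIntegral.integral_of_le hpq, integral_integral_swap
    (f := fun u ω => {r : ℝ × Ω | r.1 < Z r.2}.indicator (fun r => 2 * r.1) (u, ω)) hint]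
  have e2 : ∀ᵐ ω ∂m, ∫ u in Ioc p q, {r : ℝ × Ω | r.1 < Z r.2}.indicator (fun r => 2 * r.1) (u, ω)
      = Z ω ^ 2 - p ^ 2 := by
    filter_upwards [h] with ω hω
    have e3 : (fun u : ℝ => {r : ℝ × Ω | r.1 < Z r.2}.indicator (fun r => 2 * r.1) (u, ω))
        = (Iio (Z ω)).indicator fun u => 2 * u := by
      ext u
      by_cases h : u < Z ω
      · rw [indicator_of_mem (by exact h), indicator_of_mem (by exact h)]
      · rw [indicator_of_notMem (by exact h), indicator_of_notMem (by exact h)]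
    have e4 : Ioc p q ∩ Iio (Z ω) = Ioo p (Z ω) := by
      ext u
      exact ⟨fun h => ⟨h.1.1, h.2⟩, fun h => ⟨⟨h.1, h.2.le.trans hω.2⟩, h.2⟩⟩
    rw [e3, setIntegral_indicator measurableSet_Iio, e4, ← integral_Ioc_eq_integral_Ioo,
      ← intervalIntegral.integral_of_le hω.1, intervalIntegral.integral_const_mul, integral_id]
    ring
  have hsq : Integrable (fun ω => Z ω ^ 2) m := by
    refine Integrable.of_bound (hZ.pow_const 2).aestronglyMeasurable (max |p| |q| ^ 2) ?_
    filter_upwards [h] with ω hω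
    rw [norm_pow]
    exact pow_le_pow_left₀ (norm_nonneg _) (abs_le_max_abs_abs hω.1 hω.2) 2
  rw [integral_congr_ae e2, integral_sub hsq (integrable_const _)]
  simp

/-! ### Measurability, positivity and independence of `X`, `Y`, `W`. -/

section Anchors

variable {Ω : Type*} [MeasurableSpace Ω] {μ : Measure Ω} [IsProbabilityMeasure μ] {N : ℕ}
  {P : Fin N → Ω → ℂ} {a b : ℝ}

lemma IsBPP.measurable_X {s : Set ℂ} (hP : IsBPP μ P s) : Measurable fun ω => X (config P ω) :=
  Finset.measurable_sum _ fun k _ => hP.measurable_A k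

lemma IsBPP.measurable_B {s : Set ℂ} (hP : IsBPP μ P s) (k : Fin N) :
    Measurable fun ω => B (config P ω) k := (hP.measurable_A k).div hP.measurable_X

lemma IsBPP.measurable_arg_apply {s : Set ℂ} (hP : IsBPP μ P s) (k : Fin N) :
    Measurable fun ω => (P k ω).arg := Complex.measurable_arg.comp (hP.measurable k)

lemma IsBPP.measurable_Y {s : Set ℂ} (hP : IsBPP μ P s) : Measurable fun ω => Y (config P ω) := by
  simp only [Y_eq]
  have h1 := hP.measurable_B
  have h2 := hP.measurable_arg_apply
  simp only [config] at h1 ⊢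
  fun_prop

lemma IsBPP.measurable_W {s : Set ℂ} (hP : IsBPP μ P s) : Measurable fun ω => W (config P ω) := by
  simp only [W_eq]
  have h2 := hP.measurable_arg_apply
  simp only [config]
  fun_prop

lemma IsBPP.ae_A_pos (hP : IsBPP μ P (annulus a b)) (ha : 0 < a) (hab : a < b) :
    ∀ᵐ ω ∂μ, ∀ k, 0 < A (config P ω) k := by
  filter_upwards [hP.ae_A_mem_Icc ha hab] with ω h k
  have hb := ha.trans hab
  exact lt_of_lt_of_le (by positivity) (h k).1

lemma IsBPP.ae_arg_ne (hP : IsBPP μ P (annulus a b)) (ha : 0 < a) (hab : a < b) (k : Fin N)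
    (x : ℝ) : ∀ᵐ ω ∂μ, (P k ω).arg ≠ x := by
  have h : ∀ᵐ θ ∂angLaw, θ ≠ x := by
    have h0 : ∀ᵐ θ : ℝ, θ ≠ x := by simp [ae_iff]
    exact angLaw_absolutelyContinuous.ae_le h0
  rw [← hP.map_arg ha hab k] at h
  exact ae_of_ae_map (hP.measurable_arg_apply k).aemeasurable h

/-- A cosine equal to 1 forces the arguments to differ by a multiple of π: a countable union of null
events. -/
lemma IsBPP.ae_cos_ne_one (hP : IsBPP μ P (annulus a b)) (ha : 0 < a) (hab : a < b) {i j : Fin N}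
    (hij : i ≠ j) : ∀ᵐ ω ∂μ, Real.cos (2 * (P i ω).arg - 2 * (P j ω).arg) ≠ 1 := by
  have h : ∀ᵐ ω ∂μ, ∀ n : ℤ, (P i ω).arg ≠ (P j ω).arg + n * Real.pi := by
    rw [ae_all_iff]
    exact fun n => ae_ne_of_indepFun (hP.measurable_arg_apply i) (hP.measurable_arg_apply j)
      (hP.iIndepFun_arg.indepFun hij) (hP.ae_arg_ne ha hab i) (f := fun y => y + n * Real.pi)
      (by fun_prop)
  filter_upwards [h] with ω h h'
  obtain ⟨n, hn⟩ := (Real.cos_eq_one_iff _).1 h'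
  exact h n (by linarith)

lemma IsBPP.ae_Y_pos (hP : IsBPP μ P (annulus a b)) (hN : 3 ≤ N) (ha : 0 < a) (hab : a < b) :
    ∀ᵐ ω ∂μ, 0 < Y (config P ω) := by
  have : NeZero N := ⟨by omega⟩
  filter_upwards [hP.ae_A_pos ha hab, hP.ae_cos_ne_one ha hab (i := ⟨0, by omega⟩)
    (j := ⟨1, by omega⟩) (by simp)] with ω hA hc
  rw [Y_eq]
  exact one_sub_sq_sum_pos (B_pos hA) (sum_B_eq_one (X_pos hA).ne') hc

lemma IsBPP.ae_W_pos (hP : IsBPP μ P (annulus a b)) (hN : 3 ≤ N) (ha : 0 < a) (hab : a < b) :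
    ∀ᵐ ω ∂μ, 0 < W (config P ω) := by
  have hN0 : (N : ℝ) ≠ 0 := by exact_mod_cast (by omega : N ≠ 0)
  filter_upwards [hP.ae_cos_ne_one ha hab (i := ⟨0, by omega⟩) (j := ⟨1, by omega⟩)
    (by simp)] with ω hc
  rw [W_eq_weighted]
  exact one_sub_sq_sum_pos (fun _ => by positivity) (by simp [hN0]) hc

lemma IsBPP.integrable_Y (hP : IsBPP μ P (annulus a b)) (hN : 3 ≤ N) (ha : 0 < a) (hab : a < b) :
    Integrable (fun ω => Y (config P ω)) μ := by
  refine Integrable.of_bound hP.measurable_Y.aestronglyMeasurable 1 ?_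
  filter_upwards [hP.ae_Y_pos hN ha hab] with ω h
  rw [Real.norm_eq_abs, abs_of_pos h, Y, sub_sub]
  exact sub_le_self _ (by positivity)

lemma IsBPP.vOpt_pos (hP : IsBPP μ P (annulus a b)) (hN : 3 ≤ N) (ha : 0 < a) (hab : a < b) :
    0 < vOpt μ P := by
  have h1 : (1 : ℝ) < N := by exact_mod_cast (by omega : 1 < N)
  have hY := hP.ae_Y_pos hN ha hab
  refine div_pos ?_ (sub_pos.2 ((div_lt_one (one_pos.trans h1)).2 h1))
  rw [integral_pos_iff_support_of_nonneg_ae (hY.mono fun _ h => h.le) (hP.integrable_Y hN ha hab)]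
  have : (Function.support fun ω => Y (config P ω)) =ᵐ[μ] univ := by
    rw [eventuallyEq_univ]
    exact hY.mono fun _ h => h.ne'
  rw [measure_congr this, measure_univ]
  exact one_pos

lemma IsBPP.indepFun_X_W (hP : IsBPP μ P (annulus a b)) (ha : 0 < a) (hab : a < b) :
    IndepFun (fun ω => X (config P ω)) (fun ω => W (config P ω)) μ := by
  have h := (hP.indepFun_norm_arg ha hab).comp
    (φ := fun r : Fin N → ℝ => ∑ k, (r k ^ 2)⁻¹)
    (ψ := fun θ : Fin N → ℝ => 1 - 1 / (N : ℝ) ^ 2 *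
      ((∑ k, Real.cos (2 * θ k)) ^ 2 + (∑ k, Real.sin (2 * θ k)) ^ 2)) (by fun_prop) (by fun_prop)
  simp only [W_eq]
  exact h

/-! ### The law of `W` -/

lemma IsBPP.integral_cexp_arg (hP : IsBPP μ P (annulus a b)) (ha : 0 < a) (hab : a < b)
    (k : Fin N) (x φ : ℝ) :
    ∫ ω, Complex.exp (Complex.I * ((x * Real.cos ((2 : ℕ) * (P k ω).arg - φ) : ℝ) : ℂ)) ∂μ
      = besselJ 0 x := by
  have h := integral_map (μ := μ) (hP.measurable_arg_apply k).aemeasurable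
    (f := fun θ => Complex.exp (Complex.I * ((x * Real.cos ((2 : ℕ) * θ - φ) : ℝ) : ℂ)))
    (Continuous.aestronglyMeasurable (by fun_prop))
  have hp : (Real.pi : ℂ) ≠ 0 := by exact_mod_cast Real.pi_ne_zero
  rw [← h, hP.map_arg ha hab, integral_angLaw, integral_cexp_mul_cos x two_pos, Complex.real_smul]
  push_cast
  field_simp

/-- The random walk `∑ₖ exp (2 i Θₖ)`. -/
noncomputable def walk (P : Fin N → Ω → ℂ) (ω : Ω) : ℂ :=
  ∑ k, Complex.exp ((2 * (P k ω).arg : ℝ) * Complex.I)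

lemma norm_sq_walk (P : Fin N → Ω → ℂ) (ω : Ω) : ‖walk P ω‖ ^ 2 =
    (∑ k, Real.cos (2 * (P k ω).arg)) ^ 2 + (∑ k, Real.sin (2 * (P k ω).arg)) ^ 2 := by
  rw [Complex.sq_norm, Complex.normSq_apply, walk, Complex.re_sum, Complex.im_sum]
  simp only [Complex.exp_ofReal_mul_I_re, Complex.exp_ofReal_mul_I_im]
  ring

lemma inner_walk (P : Fin N → Ω → ℂ) (ω : Ω) (ξ : ℂ) : inner ℝ (walk P ω) ξ =
    ∑ k, ‖ξ‖ * Real.cos ((2 : ℕ) * (P k ω).arg - ξ.arg) := by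
  rw [walk, sum_inner]
  refine Finset.sum_congr rfl fun k _ => ?_
  rw [Complex.inner, Complex.mul_re, Complex.conj_re, Complex.conj_im,
    Complex.exp_ofReal_mul_I_re, Complex.exp_ofReal_mul_I_im, Real.cos_sub, Nat.cast_ofNat]
  linear_combination (-Real.cos (2 * (P k ω).arg)) * Complex.norm_mul_cos_arg ξ
    - Real.sin (2 * (P k ω).arg) * Complex.norm_mul_sin_arg ξ

lemma IsBPP.integral_cexp_inner_walk (hP : IsBPP μ P (annulus a b)) (ha : 0 < a) (hab : a < b)
    (ξ : ℂ) : ∫ ω, Complex.exp (Complex.I * ((inner ℝ (walk P ω) ξ : ℝ) : ℂ)) ∂μ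
      = ((besselJ 0 ‖ξ‖ ^ N : ℝ) : ℂ) := by
  have hm := hP.measurable_arg_apply
  have hi : iIndepFun (fun k ω => Complex.exp (Complex.I *
      ((‖ξ‖ * Real.cos ((2 : ℕ) * (P k ω).arg - ξ.arg) : ℝ) : ℂ))) μ :=
    hP.iIndepFun_arg.comp (fun k θ => Complex.exp (Complex.I *
      ((‖ξ‖ * Real.cos ((2 : ℕ) * θ - ξ.arg) : ℝ) : ℂ))) fun k => by fun_prop
  have h := hi.integral_fun_prod_eq_prod_integral fun k =>
    (Measurable.aestronglyMeasurable (by fun_prop))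
  simp only [hP.integral_cexp_arg ha hab, Finset.prod_const, Finset.card_univ,
    Fintype.card_fin] at h
  rw [Complex.ofReal_pow, ← h]
  congr 1; ext ω
  rw [← Complex.exp_sum, inner_walk, Complex.ofReal_sum, Finset.mul_sum]

lemma IsBPP.measureReal_lt_W (hP : IsBPP μ P (annulus a b)) (hN : 3 ≤ N) (ha : 0 < a)
    (hab : a < b) (w : ℝ) : μ.real {ω | w < W (config P ω)} = besselCcdf N w := by
  have hN0 : (0 : ℝ) < N := by exact_mod_cast (by omega : 0 < N)
  unfold besselCcdf
  split_ifs with h0 h1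
  · rw [← probReal_univ (μ := μ)]
    refine measureReal_congr (eventuallyEq_univ.2 ?_)
    filter_upwards [hP.ae_W_pos hN ha hab] with ω h
    exact h0.trans h
  · rcases eq_or_lt_of_le h1 with rfl | h1
    · have : {ω | 1 < W (config P ω)} = ∅ := by
        ext ω
        simpa using W_le_one (config P ω)
      simp [this]
    · have hs : 0 < √(1 - w) := Real.sqrt_pos.2 (sub_pos.2 h1)
      have hm : Measurable (walk P) := by
        have := hP.measurable_arg_apply
        unfold walk
        fun_prop
      have h := measureReal_norm_lt hm (ψ := fun y => besselJ 0 y ^ N)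
        (hP.integral_cexp_inner_walk ha hab) (integrableOn_besselJ_zero_pow hN)
        (mul_pos hN0 hs)
      have hset : {ω | w < W (config P ω)} = {ω | ‖walk P ω‖ < N * √(1 - w)} := by
        ext ω
        change w < W (config P ω) ↔ ‖walk P ω‖ < N * √(1 - w)
        rw [← sq_lt_sq₀ (norm_nonneg _) (by positivity), norm_sq_walk, mul_pow,
          Real.sq_sqrt (sub_pos.2 h1).le, W_eq, one_div, lt_sub_comm, inv_mul_lt_iff₀ (by positivity)]
        rfl
      rw [hset, h]
      rfl
  · have : {ω | w < W (config P ω)} = ∅ := by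
      ext ω
      simpa using (W_le_one (config P ω)).trans (not_le.1 h1).le
    simp [this]

lemma integrableOn_besselIntegrand (hN : 3 ≤ N) (w : ℝ) :
    IntegrableOn (besselIntegrand N w) (Ioi 0) :=
  (integrableOn_besselJ_zero_pow hN).bdd_mul (c := 1)
    (continuous_besselJ_one.comp (by fun_prop)).aestronglyMeasurable
    (.of_forall fun _ => abs_besselJ_le_one 1 _)

/-! ### The law of `X` -/

lemma X_eq_sum (p : Fin N → ℂ) : X p = ∑ k, (1 : ℝ) * A p k := by simp [X]

lemma prod_phiA_one_mul (a b : ℝ) (N : ℕ) :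
    (fun t => ∏ _j : Fin N, phiA a b (1 * t)) = phiX N a b := by
  ext t
  simp [phiX]

lemma IsBPP.charFun_X (hP : IsBPP μ P (annulus a b)) (ha : 0 < a) (hab : a < b) (t : ℝ) :
    charFun (μ.map fun ω => X (config P ω)) t = phiX N a b t := by
  rw [charFun_apply_real, integral_map hP.measurable_X.aemeasurable
    (Continuous.aestronglyMeasurable (by fun_prop)), ← prod_phiA_one_mul]
  refine Eq.trans ?_ (hP.integral_cexp_sum_A ha hab (fun _ => 1) t)
  congr 1; ext ω
  rw [← X_eq_sum, mul_comm Complex.I]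
  push_cast
  rfl

lemma IsBPP.gilPelaez_X (hP : IsBPP μ P (annulus a b)) (hN : 3 ≤ N) (ha : 0 < a) (hab : a < b)
    (x : ℝ) : IntegrableOn (gilPelaezIntegrand (phiX N a b) x) (Ioi 0) ∧
      μ.real {ω | x < X (config P ω)} = gilPelaezCcdf (phiX N a b) x := by
  have h := hP.gilPelaez_sum_A ha hab (c := fun _ => 1) (k := ⟨0, by omega⟩) one_ne_zero x
  rw [prod_phiA_one_mul] at h
  simpa only [X_eq_sum] using h

lemma IsBPP.ae_X_ne (hP : IsBPP μ P (annulus a b)) (hN : 3 ≤ N) (ha : 0 < a) (hab : a < b)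
    (x : ℝ) : ∀ᵐ ω ∂μ, X (config P ω) ≠ x := by
  simpa only [X_eq_sum] using
    hP.ae_sum_A_ne ha hab (c := fun _ => 1) (k := ⟨0, by omega⟩) one_ne_zero x

/-! ### The mean of `Y` -/

lemma prod_phiA_ite (a b u t : ℝ) (k : Fin N) :
    ∏ j, phiA a b (((if j = k then 1 else 0) - u) * t) = phiT N a b u t := by
  rw [← Finset.mul_prod_erase _ _ (Finset.mem_univ k), if_pos rfl, phiT]
  congr 1
  rw [Finset.prod_congr rfl (g := fun _ => phiA a b (-(u * t))), Finset.prod_const,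
    Finset.card_erase_of_mem (Finset.mem_univ k), Finset.card_univ, Fintype.card_fin]
  intro j hj
  rw [if_neg (Finset.ne_of_mem_erase hj)]
  congr 1
  ring

/-- Multiplying by `X > 0` makes `B k > u` a sign condition linear in the independent `Aⱼ`. `u ≠ 1`
keeps the coefficient of `A k` nonzero, which supplies the decay. -/
lemma IsBPP.gilPelaez_B (hP : IsBPP μ P (annulus a b)) (ha : 0 < a) (hab : a < b)
    {u : ℝ} (hu : u ≠ 1) (k : Fin N) :
    IntegrableOn (fun t => (phiT N a b u t).im / t) (Ioi 0) ∧
      μ.real {ω | u < B (config P ω) k}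
        = 1 / 2 + 1 / Real.pi * ∫ t in Ioi (0 : ℝ), (phiT N a b u t).im / t := by
  have : NeZero N := ⟨(Fin.pos k).ne'⟩
  have h := hP.gilPelaez_sum_A ha hab (c := fun j => (if j = k then 1 else 0) - u) (k := k)
    (by simpa [sub_eq_zero] using hu.symm) 0
  simp only [prod_phiA_ite] at h
  have e : gilPelaezIntegrand (phiT N a b u) 0 = fun t => (phiT N a b u t).im / t := by
    ext t
    simp [gilPelaezIntegrand]
  simp only [gilPelaezCcdf, e] at h
  refine ⟨h.1, ?_⟩
  rw [← h.2]
  refine measureReal_congr ?_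
  filter_upwards [hP.ae_A_pos ha hab] with ω hA
  refine propext ?_
  change u < B (config P ω) k ↔ 0 < ∑ j, ((if j = k then 1 else 0) - u) * A (config P ω) j
  simp only [sub_mul, Finset.sum_sub_distrib, ite_mul, one_mul, zero_mul, Finset.sum_ite_eq',
    Finset.mem_univ, if_true, ← Finset.mul_sum]
  rw [B, lt_div_iff₀ (X_pos hA), sub_pos, X]

lemma IsBPP.integrableOn_meanIntegrand (hP : IsBPP μ P (annulus a b)) (hN : 3 ≤ N) (ha : 0 < a)
    (hab : a < b) {u : ℝ} (hu : u ∈ Icc (rhoMin N a b) (rhoMax N a b)) :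
    IntegrableOn (meanIntegrand N a b u) (Ioi 0) :=
  (hP.gilPelaez_B ha hab (hu.2.trans_lt (rhoMax_lt_one hN ha (ha.trans hab))).ne
    ⟨0, by omega⟩).1.const_mul u

lemma IsBPP.integral_meanIntegrand (hP : IsBPP μ P (annulus a b)) (hN : 3 ≤ N) (ha : 0 < a)
    (hab : a < b) {u : ℝ} (hu : u ∈ Icc (rhoMin N a b) (rhoMax N a b)) (k : Fin N) :
    ∫ t in Ioi (0 : ℝ), meanIntegrand N a b u t
      = u * (Real.pi * (μ.real {ω | u < B (config P ω) k} - 1 / 2)) := by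
  simp only [meanIntegrand]
  rw [integral_const_mul,
    (hP.gilPelaez_B ha hab (hu.2.trans_lt (rhoMax_lt_one hN ha (ha.trans hab))).ne k).2]
  field_simp
  ring

lemma antitone_measureReal_lt (Z : Ω → ℝ) : Antitone fun u => μ.real {ω | u < Z ω} :=
  fun _ _ huv => measureReal_mono fun _ (h : _ < _) => lt_of_le_of_lt huv h

/-- By Gil-Pelaez the inner integral is `u π (P(B > u) - 1/2)`, a continuous function times a
monotone one up to a constant. -/
lemma IsBPP.intervalIntegrable_meanIntegrand (hP : IsBPP μ P (annulus a b)) (hN : 3 ≤ N)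
    (ha : 0 < a) (hab : a < b) :
    IntervalIntegrable (fun u => ∫ t in Ioi (0 : ℝ), meanIntegrand N a b u t) volume
      (rhoMin N a b) (rhoMax N a b) := by
  have h : IntervalIntegrable (fun u => u * (Real.pi *
      (μ.real {ω | u < B (config P ω) ⟨0, by omega⟩} - 1 / 2))) volume
      (rhoMin N a b) (rhoMax N a b) :=
    (((antitone_measureReal_lt _).intervalIntegrable.sub intervalIntegrable_const).const_mul
      _).continuousOn_mul continuousOn_id
  refine h.congr fun u hu => ?_
  rw [uIoc_of_le (rhoMin_le_rhoMax hN ha hab)] at hu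
  exact (hP.integral_meanIntegrand hN ha hab (Ioc_subset_Icc_self hu) _).symm

lemma IsBPP.integral_B_sq (hP : IsBPP μ P (annulus a b)) (hN : 3 ≤ N) (ha : 0 < a) (hab : a < b)
    (k : Fin N) : ∫ ω, B (config P ω) k ^ 2 ∂μ =
      (rhoMax N a b ^ 2 + rhoMin N a b ^ 2) / 2
        + 2 / Real.pi * ∫ u in rhoMin N a b..rhoMax N a b,
          ∫ t in Ioi (0 : ℝ), meanIntegrand N a b u t := by
  have hle := rhoMin_le_rhoMax hN ha hab
  rw [integral_sq_eq_add_integral (hP.measurable_B k) hle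
    ((hP.ae_A_mem_Icc ha hab).mono fun ω h => B_mem_Icc hN ha hab h k)]
  -- The summand `u`, from the `1/2` of Gil-Pelaez, integrates to `(ρmax² - ρmin²)/2`; with the
  -- `ρmin²` of the layer-cake formula this makes `(ρmax² + ρmin²)/2`.
  have e : ∀ u ∈ uIcc (rhoMin N a b) (rhoMax N a b), 2 * u * μ.real {ω | u < B (config P ω) k}
      = u + 2 / Real.pi * ∫ t in Ioi (0 : ℝ), meanIntegrand N a b u t := by
    intro u hu
    rw [uIcc_of_le hle] at hu
    rw [hP.integral_meanIntegrand hN ha hab hu k]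
    field_simp
    ring
  rw [intervalIntegral.integral_congr e, intervalIntegral.integral_add
    (Continuous.intervalIntegrable (by fun_prop) _ _)
    ((hP.intervalIntegrable_meanIntegrand hN ha hab).const_mul _),
    intervalIntegral.integral_const_mul, integral_id]
  ring

lemma IsBPP.integral_cos_arg (hP : IsBPP μ P (annulus a b)) (ha : 0 < a) (hab : a < b)
    (k : Fin N) : ∫ ω, Real.cos (2 * (P k ω).arg) ∂μ = 0 := by
  have h := integral_map (μ := μ) (hP.measurable_arg_apply k).aemeasurable
    (f := fun θ => Real.cos (2 * θ)) (Continuous.aestronglyMeasurable (by fun_prop))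
  rw [← h, hP.map_arg ha hab, integral_angLaw,
    intervalIntegral.integral_comp_mul_left Real.cos two_ne_zero, integral_cos]
  simp

lemma IsBPP.integral_sin_arg (hP : IsBPP μ P (annulus a b)) (ha : 0 < a) (hab : a < b)
    (k : Fin N) : ∫ ω, Real.sin (2 * (P k ω).arg) ∂μ = 0 := by
  have h := integral_map (μ := μ) (hP.measurable_arg_apply k).aemeasurable
    (f := fun θ => Real.sin (2 * θ)) (Continuous.aestronglyMeasurable (by fun_prop))
  rw [← h, hP.map_arg ha hab, integral_angLaw,
    intervalIntegral.integral_comp_mul_left Real.sin two_ne_zero, integral_sin]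
  simp

lemma IsBPP.integral_cos_arg_sub (hP : IsBPP μ P (annulus a b)) (ha : 0 < a) (hab : a < b)
    {j k : Fin N} (hjk : j ≠ k) :
    ∫ ω, Real.cos (2 * (P j ω).arg - 2 * (P k ω).arg) ∂μ = 0 := by
  have hm := hP.measurable_arg_apply
  have hi := hP.iIndepFun_arg.indepFun hjk
  have hc := (hi.comp (φ := fun x => Real.cos (2 * x)) (ψ := fun x => Real.cos (2 * x))
    (by fun_prop) (by fun_prop)).integral_fun_mul_eq_mul_integral
    (Measurable.aestronglyMeasurable (by simp only [Function.comp_def]; fun_prop))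
    (Measurable.aestronglyMeasurable (by simp only [Function.comp_def]; fun_prop))
  have hs := (hi.comp (φ := fun x => Real.sin (2 * x)) (ψ := fun x => Real.sin (2 * x))
    (by fun_prop) (by fun_prop)).integral_fun_mul_eq_mul_integral
    (Measurable.aestronglyMeasurable (by simp only [Function.comp_def]; fun_prop))
    (Measurable.aestronglyMeasurable (by simp only [Function.comp_def]; fun_prop))
  simp only [Function.comp_def, hP.integral_cos_arg ha hab, hP.integral_sin_arg ha hab,
    mul_zero] at hc hs
  simp only [Real.cos_sub]
  rw [integral_add, hc, hs, add_zero]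
  · refine Integrable.of_bound (Measurable.aestronglyMeasurable (by fun_prop)) 1
      (.of_forall fun ω => ?_)
    rw [norm_mul]
    exact mul_le_one₀ (Real.abs_cos_le_one _) (norm_nonneg _) (Real.abs_cos_le_one _)
  · refine Integrable.of_bound (Measurable.aestronglyMeasurable (by fun_prop)) 1
      (.of_forall fun ω => ?_)
    rw [norm_mul]
    exact mul_le_one₀ (Real.abs_sin_le_one _) (norm_nonneg _) (Real.abs_sin_le_one _)

/-- The weights depend on the radii alone, so off the diagonal the mean factors and the cosine
contributes 0. -/
lemma IsBPP.integral_B_mul_B_mul_cos (hP : IsBPP μ P (annulus a b)) (ha : 0 < a) (hab : a < b)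
    (j k : Fin N) :
    ∫ ω, B (config P ω) j * B (config P ω) k * Real.cos (2 * (P j ω).arg - 2 * (P k ω).arg) ∂μ
      = if j = k then ∫ ω, B (config P ω) k ^ 2 ∂μ else 0 := by
  split_ifs with hjk
  · subst hjk
    simp [sq]
  · have hm := hP.measurable_arg_apply
    have h := ((hP.indepFun_norm_arg ha hab).comp
      (φ := fun r : Fin N → ℝ => (r j ^ 2)⁻¹ / (∑ i, (r i ^ 2)⁻¹) *
        ((r k ^ 2)⁻¹ / (∑ i, (r i ^ 2)⁻¹)))
      (ψ := fun θ : Fin N → ℝ => Real.cos (2 * θ j - 2 * θ k))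
      (by fun_prop) (by fun_prop)).integral_fun_mul_eq_mul_integral
      ((hP.measurable_B j).mul (hP.measurable_B k)).aestronglyMeasurable
      (Measurable.aestronglyMeasurable (by simp only [Function.comp_def]; fun_prop))
    simp only [Function.comp_def, hP.integral_cos_arg_sub ha hab hjk, mul_zero] at h
    exact h

lemma IsBPP.integral_Y (hP : IsBPP μ P (annulus a b)) (hN : 3 ≤ N) (ha : 0 < a) (hab : a < b) :
    ∫ ω, Y (config P ω) ∂μ = meanY N a b := by
  have hm := hP.measurable_arg_apply
  have hB := hP.measurable_B
  have e : ∀ ω, Y (config P ω) = 1 - ∑ j, ∑ k, B (config P ω) j * B (config P ω) k *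
      Real.cos (2 * (P j ω).arg - 2 * (P k ω).arg) := by
    intro ω
    rw [Y_eq, sub_sub, sq_sum_cos_add_sq_sum_sin]
    rfl
  have hint : ∀ j k, Integrable (fun ω => B (config P ω) j * B (config P ω) k *
      Real.cos (2 * (P j ω).arg - 2 * (P k ω).arg)) μ := by
    intro j k
    refine Integrable.of_bound (Measurable.aestronglyMeasurable (by fun_prop)) 1 ?_
    filter_upwards [hP.ae_A_mem_Icc ha hab] with ω h
    have h0 := rhoMin_pos hN ha (ha.trans hab)
    have h1 := rhoMax_lt_one hN ha (ha.trans hab)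
    have hb : ∀ i, ‖B (config P ω) i‖ ≤ 1 := fun i => by
      have := B_mem_Icc hN ha hab h i
      rw [Real.norm_eq_abs, abs_of_nonneg (h0.le.trans this.1)]
      exact this.2.trans h1.le
    rw [norm_mul, norm_mul]
    exact mul_le_one₀ (mul_le_one₀ (hb j) (norm_nonneg _) (hb k)) (norm_nonneg _)
      (Real.abs_cos_le_one _)
  simp only [e]
  rw [integral_sub (integrable_const _)
    (integrable_finsetSum _ fun j _ => integrable_finsetSum _ fun k _ => hint j k),
    integral_finsetSum _ fun j _ => integrable_finsetSum _ fun k _ => hint j k]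
  simp only [integral_finsetSum _ fun k _ => hint _ k, hP.integral_B_mul_B_mul_cos ha hab,
    Finset.sum_ite_eq, Finset.mem_univ, if_true, hP.integral_B_sq hN ha hab, Finset.sum_const,
    Finset.card_univ, Fintype.card_fin, nsmul_eq_mul, meanY]
  simp

/-! ### The approximation of the error bound -/

lemma measureReal_comp_lt_eq_integral {U V : Ω → ℝ} (hU : Measurable U) (hV : Measurable V)
    (h : IndepFun U V μ) {c : ℝ → ℝ} (hc : Measurable c) :
    μ.real {ω | c (U ω) < V ω} = ∫ x, μ.real {ω | c x < V ω} ∂(μ.map U) := by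
  have hm := (indepFun_iff_map_prod_eq_prod_map_map hU.aemeasurable hV.aemeasurable).1 h
  have hs : MeasurableSet {p : ℝ × ℝ | c p.1 < p.2} :=
    measurableSet_lt (hc.comp measurable_fst) measurable_snd
  have := Measure.isProbabilityMeasure_map (μ := μ) hU.aemeasurable
  have := Measure.isProbabilityMeasure_map (μ := μ) hV.aemeasurable
  have h1 : μ {ω | c (U ω) < V ω} = ∫⁻ x, μ {ω | c x < V ω} ∂(μ.map U) := by
    have h2 : μ {ω | c (U ω) < V ω} = μ.map (fun ω => (U ω, V ω)) {p | c p.1 < p.2} := by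
      rw [Measure.map_apply (hU.prodMk hV) hs]
      rfl
    rw [h2, hm, Measure.prod_apply hs]
    refine lintegral_congr fun x => ?_
    rw [Measure.map_apply hV (measurable_prodMk_left hs)]
    rfl
  have ha : Antitone fun u => μ {ω | u < V ω} :=
    fun _ _ huv => measure_mono fun _ (h : _ < _) => lt_of_le_of_lt huv h
  simp only [Measure.real]
  rw [h1]
  exact (integral_toReal (f := fun x => μ {ω | c x < V ω}) (ha.measurable.comp hc).aemeasurable
    (.of_forall fun _ => measure_lt_top _ _)).symm

lemma IsBPP.ae_pos_mul_V (hP : IsBPP μ P (annulus a b)) (hN : 3 ≤ N) (ha : 0 < a) (hab : a < b)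
    {Ts : ℝ} (hTs : 0 < Ts) : ∀ᵐ ω ∂μ, 0 < Ts * X (config P ω) * V μ P ω := by
  have : NeZero N := ⟨by omega⟩
  filter_upwards [hP.ae_A_pos ha hab, hP.ae_W_pos hN ha hab] with ω hA hW
  exact mul_pos (mul_pos hTs (X_pos hA)) (mul_pos (hP.vOpt_pos hN ha hab) hW)

lemma IsBPP.ccdf_spebApprox (hP : IsBPP μ P (annulus a b)) (hN : 3 ≤ N) (ha : 0 < a) (hab : a < b)
    {Ts : ℝ} (hTs : 0 < Ts) {u : ℝ} (hu : 0 < u) :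
    Integrable (fun x => besselCcdf N (4 / (Ts * u * x * vOpt μ P)))
      (μ.map (fun ω => X (config P ω))) ∧
    μ.real {ω | u < spebApprox μ P Ts ω} =
      1 - ∫ x, besselCcdf N (4 / (Ts * u * x * vOpt μ P)) ∂(μ.map (fun ω => X (config P ω))) := by
  have : NeZero N := ⟨by omega⟩
  have hv := hP.vOpt_pos hN ha hab
  have hX := hP.measurable_X
  have hW := hP.measurable_W
  have hXW := hP.indepFun_X_W ha hab
  have hc : Measurable fun x => 4 / (Ts * u * x * vOpt μ P) := by fun_prop
  have := Measure.isProbabilityMeasure_map (μ := μ) hX.aemeasurable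
  simp only [← hP.measureReal_lt_W hN ha hab]
  constructor
  · refine Integrable.of_bound ((antitone_measureReal_lt _).measurable.comp hc).aestronglyMeasurable
      1 (.of_forall fun x => ?_)
    rw [Real.norm_eq_abs, abs_of_nonneg measureReal_nonneg]
    exact measureReal_le_one
  · have hcX : Measurable fun ω => 4 / (Ts * u * X (config P ω) * vOpt μ P) := hc.comp hX
    rw [← measureReal_comp_lt_eq_integral hX hW hXW hc,
      ← probReal_compl_eq_one_sub (measurableSet_lt hcX hW)]
    refine measureReal_congr ?_
    -- The complement of `c(X) < W` is `W ≤ c(X)`, while the event wanted is strict. Equality would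
    -- make `X` a function of the independent `W`, which is null as `X` has no atoms.
    have hne := ae_ne_of_indepFun hX hW hXW (hP.ae_X_ne hN ha hab)
      (f := fun w => 4 / (Ts * u * w * vOpt μ P)) (by fun_prop)
    filter_upwards [hne, hP.ae_A_pos ha hab, hP.ae_W_pos hN ha hab] with ω h1 hA hW0
    have hX0 := X_pos hA
    refine propext ?_
    change u < spebApprox μ P Ts ω ↔
      ¬ (4 / (Ts * u * X (config P ω) * vOpt μ P) < W (config P ω))
    have e : W (config P ω) ≠ 4 / (Ts * u * X (config P ω) * vOpt μ P) := by
      intro h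
      refine h1 ?_
      rw [eq_div_iff (by positivity)] at h ⊢
      linarith
    rw [not_lt, le_iff_lt_or_eq, or_iff_left e, spebApprox, V, lt_div_iff₀ (by positivity),
      lt_div_iff₀ (by positivity)]
    ring_nf

end Anchors

end SPEB

theorem theorem1 {Ω : Type*} [MeasurableSpace Ω] (μ : Measure Ω) [IsProbabilityMeasure μ]
    (N : ℕ) (hN : 3 ≤ N) (dmin dmax Ts : ℝ) (hdmin : 0 < dmin) (hdmax : dmin < dmax)
    (hTs : 0 < Ts) (P : Fin N → Ω → ℂ) (hP : SPEB.IsBPP μ P (SPEB.annulus dmin dmax)) :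
    -- the SPEB is `4 / (Ts X_N Y_N)`; the approximation replaces `Y_N` by `V_N`
    (∀ᵐ ω ∂μ, IsUnit (SPEB.infoMatrix Ts (SPEB.config P ω)).det ∧
      0 < Ts * SPEB.X (SPEB.config P ω) * SPEB.Y (SPEB.config P ω) ∧
      SPEB.speb Ts (SPEB.config P ω) =
        4 / (Ts * SPEB.X (SPEB.config P ω) * SPEB.Y (SPEB.config P ω))) ∧
    (∀ᵐ ω ∂μ, 0 < Ts * SPEB.X (SPEB.config P ω) * SPEB.V μ P ω) ∧
    -- `X_N` and `W_N` are independent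
    IndepFun (fun ω => SPEB.X (SPEB.config P ω)) (fun ω => SPEB.W (SPEB.config P ω)) μ ∧
    -- the ccdf of `W_N` is the random-walk formula
    (∀ w ∈ Icc (0 : ℝ) 1, IntegrableOn (SPEB.besselIntegrand N w) (Ioi 0)) ∧
    (∀ w : ℝ, μ.real {ω | w < SPEB.W (SPEB.config P ω)} = SPEB.besselCcdf N w) ∧
    -- the characteristic function of `X_N`, and its ccdf by Gil-Pelaez inversion
    (∀ t : ℝ, charFun (μ.map (fun ω => SPEB.X (SPEB.config P ω))) t
      = SPEB.phiX N dmin dmax t) ∧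
    (∀ x : ℝ, IntegrableOn (SPEB.gilPelaezIntegrand (SPEB.phiX N dmin dmax) x) (Ioi 0)) ∧
    (∀ x : ℝ, μ.real {ω | x < SPEB.X (SPEB.config P ω)}
      = SPEB.gilPelaezCcdf (SPEB.phiX N dmin dmax) x) ∧
    -- the closed form of `E[Y_N]`, which gives `v_opt`
    (∀ u ∈ Icc (SPEB.rhoMin N dmin dmax) (SPEB.rhoMax N dmin dmax),
      IntegrableOn (SPEB.meanIntegrand N dmin dmax u) (Ioi 0)) ∧
    IntervalIntegrable (fun u => ∫ t in Ioi (0 : ℝ), SPEB.meanIntegrand N dmin dmax u t) volume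
      (SPEB.rhoMin N dmin dmax) (SPEB.rhoMax N dmin dmax) ∧
    Integrable (fun ω => SPEB.Y (SPEB.config P ω)) μ ∧
    ∫ ω, SPEB.Y (SPEB.config P ω) ∂μ = SPEB.meanY N dmin dmax ∧
    -- the ccdf of the approximation
    (∀ u : ℝ, 0 < u →
      Integrable (fun x => SPEB.besselCcdf N (4 / (Ts * u * x * SPEB.vOpt μ P)))
        (μ.map (fun ω => SPEB.X (SPEB.config P ω))) ∧
      μ.real {ω | u < SPEB.spebApprox μ P Ts ω} =
        1 - ∫ x, SPEB.besselCcdf N (4 / (Ts * u * x * SPEB.vOpt μ P))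
          ∂(μ.map (fun ω => SPEB.X (SPEB.config P ω)))) := by
  have : NeZero N := ⟨by omega⟩
  have hX : ∀ᵐ ω ∂μ, 0 < SPEB.X (SPEB.config P ω) :=
    (hP.ae_A_pos hdmin hdmax).mono fun ω h => SPEB.X_pos h
  refine ⟨?_, hP.ae_pos_mul_V hN hdmin hdmax hTs, hP.indepFun_X_W hdmin hdmax,
    fun w _ => SPEB.integrableOn_besselIntegrand hN w, hP.measureReal_lt_W hN hdmin hdmax,
    hP.charFun_X hdmin hdmax, fun x => (hP.gilPelaez_X hN hdmin hdmax x).1,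
    fun x => (hP.gilPelaez_X hN hdmin hdmax x).2,
    fun u hu => hP.integrableOn_meanIntegrand hN hdmin hdmax hu,
    hP.intervalIntegrable_meanIntegrand hN hdmin hdmax, hP.integrable_Y hN hdmin hdmax,
    hP.integral_Y hN hdmin hdmax, fun u hu => hP.ccdf_spebApprox hN hdmin hdmax hTs hu⟩
  filter_upwards [hX, hP.ae_Y_pos hN hdmin hdmax] with ω h1 h2
  refine ⟨?_, by positivity, SPEB.speb_eq hTs h1 h2⟩
  rw [SPEB.det_infoMatrix Ts h1.ne']
  have hd : 0 < Ts ^ 2 / 4 * SPEB.X (SPEB.config P ω) ^ 2 * SPEB.Y (SPEB.config P ω) := by positivity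
  exact hd.ne'.isUnit
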